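/- Let $\Omega=(x_0,x_n)\subset\mathbb R$ be a bounded interval with a mesh $x_0<x_1<\dots<x_n$, $n\ge 1$, elements $K=(x_{i-1},x_i)$ forming $\mathcal T_h$, and vertex set $\mathcal V_h=\{x_0,\dots,x_n\}$; let $\mathcal V_K$ be the set of the two end points of $K$. Write $(v,w)_D=\int_D vw$, $\|v\|_D=(v,v)_D^{1/2}$, and $P_k(\mathcal T)$ for the piecewise polynomials of degree at most $k$ on a set $\mathcal T$ of elements. Let $\beta\in\mathbb R\setminus\{0\}$ and $f\in L^2(\Omega)$; the outflow vertex is $x_n$ if $\beta>0$ and $x_0$ if $\beta<0$. Let $u\in L^2(\Omega)$ be the ultra-weak solution of the advection problem: $-(u,\beta v')_\Omega=(f,v)_\Omega$ for all $v\in H^1(\Omega)$ vanishing at the outflow vertex. For a vertex $a$ let $\mathcal T_a$ be the set of the (one or two) elements having $a$ as an end point, $\omega_a$ the corresponding open interval, $h_{\omega_a}$ its length, and $\psi_a$ the continuous piecewise affine hat function with value $1$ at $a$ and $0$ at all other vertices. Let $C_{\mathrm{PF},\omega_a}$ be the best constant $c$ in the Poincaré inequality $\|v-\bar v\|_{\omega_a}\le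 h_{\omega_a}c\,\|v'\|_{\omega_a}$ for all $v\in H^1(\omega_a)$ with mean value $\bar v$ if $a$ is not the outflow vertex, and in the Friedrichs inequality $\|v\|_{\omega_a}\le h_{\omega_a}c\,\|v'\|_{\omega_a}$ for all $v\in H^1(\omega_a)$ with $v(a)=0$ if $a$ is the outflow vertex. Set $$C_{\mathrm{cont,PF}}=\max_{a\in\mathcal V_h}\bigl(1+C_{\mathrm{PF},\omega_a}h_{\omega_a}\|\psi_a'\|_\infty\bigr).$$ Let $u_h\in P_k(\mathcal T_h)$, $k\ge0$, satisfy $(f,\psi_a)_{\omega_a}+(u_h,\beta\psi_a')_{\omega_a}=0$ for every vertex $a$ other than the outflow vertex. Let $k'\ge k$. For each vertex $a$ let $s_h^a\in P_{k'}(\mathcal T_a)\cap H^1(\omega_a)$ be the solution of $$(\beta(\psi_as_h^a)',v_h)_{\omega_a}=(f\psi_a+\beta\psi_a'u_h,v_h)_{\omega_a}\qquad\forall v_h\in P_{k'}(\mathcal T_a),$$ and set $s_h=\sum_{a\in\mathcal V_h}\psi_as_h^a$. Then, for all $K\in\mathcal T_h$, $$\|u_h-s_h\|_K\le C_{\mathrm{cont,PF}}\sum_{a\in\mathcal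 V_K}\|u-u_h\|_{\omega_a}+\sum_{a\in\mathcal V_K}\frac{h_{\omega_a}}{\pi|\beta|}\,\bigl\|(I-\Pi_{P_{k'}(\mathcal T_a)})(f\psi_a)\bigr\|_{\omega_a},$$ where $\Pi_{P_{k'}(\mathcal T_a)}$ is the $L^2(\omega_a)$-orthogonal projection onto $P_{k'}(\mathcal T_a)$. Moreover, $C_{\mathrm{cont,PF}}$ is bounded by a quantity depending only on the mesh shape regularity: there is a function $C:\mathbb R\to\mathbb R$, independent of all data above, such that $C_{\mathrm{cont,PF}}\le C(\kappa)$ whenever the lengths of any two neighboring elements differ at most by the factor $\kappa$; in particular the bound does not depend on $\beta$, $f$, $k$ or $k'$. -/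

import Mathlib

open MeasureTheory Set
open scoped ContDiff

noncomputable section

namespace Advection

/-! ### Functions on an interval

Functions on a bounded open interval are represented by functions `ℝ → ℝ`, of which only the
values on that interval (up to null sets) matter. -/

/-- `v ∈ L²(lo, hi)`. -/
def IsL2 (lo hi : ℝ) (v : ℝ → ℝ) : Prop :=
  MemLp v 2 (volume.restrict (Ioo lo hi))

/-- The scalar product `(v, w)_D` for `D = (lo, hi)`, where `lo ≤ hi`. -/
def ip (lo hi : ℝ) (v w : ℝ → ℝ) : ℝ :=
  ∫ t in lo..hi, v t * w t

/-- The norm `‖v‖_D = √(v, v)_D` for `D = (lo, hi)`, where `lo ≤ hi`. -/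
def l2norm (lo hi : ℝ) (v : ℝ → ℝ) : ℝ :=
  Real.sqrt (ip lo hi v v)

/-- `g` is a weak derivative of `v` on `(lo, hi)`. -/
def HasWeakDeriv (lo hi : ℝ) (v g : ℝ → ℝ) : Prop :=
  ∀ φ : ℝ → ℝ, ContDiff ℝ ∞ φ → HasCompactSupport φ → tsupport φ ⊆ Ioo lo hi →
    ∫ t in lo..hi, v t * deriv φ t = -∫ t in lo..hi, g t * φ t

/-- `v ∈ H¹(lo, hi)` with weak derivative `g`. Each class in `H¹(lo, hi)` is represented by its
unique representative that is continuous on `[lo, hi]` (hence is in `L²`); the traces of `v` are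
then its values `v lo` and `v hi`. -/
structure IsH1 (lo hi : ℝ) (v g : ℝ → ℝ) : Prop where
  continuousOn : ContinuousOn v (Icc lo hi)
  memLp_deriv : IsL2 lo hi g
  weakDeriv : HasWeakDeriv lo hi v g

/-- The best constant `C_P` in the Poincaré inequality `‖v - v̄‖_D ≤ h_D C_P ‖v'‖_D` for all
`v ∈ H¹(D)`, where `D = (lo, hi)`, `h_D = hi - lo` and `v̄` is the mean value of `v` on `D`. -/
def poincareConst (lo hi : ℝ) : ℝ :=
  sInf {c : ℝ | 0 < c ∧ ∀ v g : ℝ → ℝ, IsH1 lo hi v g →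
    l2norm lo hi (fun t => v t - (∫ r in lo..hi, v r) / (hi - lo)) ≤
      (hi - lo) * c * l2norm lo hi g}

/-- The best constant `C_F` in the Friedrichs inequality `‖v‖_D ≤ h_D C_F ‖v'‖_D` for all
`v ∈ H¹(D)` vanishing at the end point `e` of `D = (lo, hi)`. -/
def friedrichsConst (lo hi e : ℝ) : ℝ :=
  sInf {c : ℝ | 0 < c ∧ ∀ v g : ℝ → ℝ, IsH1 lo hi v g → v e = 0 →
    l2norm lo hi v ≤ (hi - lo) * c * l2norm lo hi g}

/-! ### Meshes -/

/-- A mesh of the bounded interval `Ω = (x 0, x n)` with vertices `x 0 < x 1 < ⋯ < x n` and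
elements `K i = (x i, x (i + 1))`. Vertices are indexed by `Fin (n + 1)`, elements by `Fin n`. -/
structure Mesh where
  n : ℕ
  n_pos : 0 < n
  x : Fin (n + 1) → ℝ
  strictMono : StrictMono x

namespace Mesh

variable (T : Mesh)

/-- The left end of `Ω`. -/
def lo : ℝ := T.x 0

/-- The right end of `Ω`. -/
def hi : ℝ := T.x (Fin.last T.n)

/-- The diameter of the element `K i`. -/
def elemDiam (i : Fin T.n) : ℝ := T.x i.succ - T.x i.castSucc

/-- The two vertices of the element `K i`. -/
def elemVertices (i : Fin T.n) : Finset (Fin (T.n + 1)) := {i.castSucc, i.succ}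

/-- Two neighboring elements are of comparable size, up to the constant `κ`. -/
def ShapeRegular (κ : ℝ) : Prop :=
  ∀ i j : Fin T.n, i.succ = j.castSucc →
    T.elemDiam i ≤ κ * T.elemDiam j ∧ T.elemDiam j ≤ κ * T.elemDiam i

/-- The left end of the patch `ω a`: the previous vertex, or `x 0` itself if `a = 0`. -/
def pl (a : Fin (T.n + 1)) : ℝ := T.x ⟨a.val - 1, by omega⟩

/-- The right end of the patch `ω a`: the next vertex, or `x n` itself if `a = n`. -/
def pr (a : Fin (T.n + 1)) : ℝ := T.x ⟨min (a.val + 1) T.n, by omega⟩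

/-- The diameter of the patch `ω a = (pl a, pr a)`. -/
def patchDiam (a : Fin (T.n + 1)) : ℝ := T.pr a - T.pl a

/-- The hat function of the vertex `a`, as a function on the closure of `Ω`: piecewise affine,
`1` at `x a` and `0` at the other vertices. -/
def hat (a : Fin (T.n + 1)) (t : ℝ) : ℝ :=
  if t = T.x a then 1
  else if t ∈ Ioo (T.pl a) (T.x a) then (t - T.pl a) / (T.x a - T.pl a)
  else if t ∈ Ioo (T.x a) (T.pr a) then (T.pr a - t) / (T.pr a - T.x a)
  else 0

/-- `‖∇ψ_a‖_∞`, where the gradient is taken almost everywhere. -/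
def hatGradSup (a : Fin (T.n + 1)) : ℝ :=
  (eLpNorm (deriv (T.hat a)) ⊤ (volume.restrict (Ioo T.lo T.hi))).toReal

/-- `v` is a polynomial of degree at most `k` on the element `K i`. -/
def IsPolyOn (k : ℕ) (i : Fin T.n) (v : ℝ → ℝ) : Prop :=
  ∃ p : Polynomial ℝ, p.natDegree ≤ k ∧
    ∀ t ∈ Ioo (T.x i.castSucc) (T.x i.succ), v t = p.eval t

/-- `v` is in `P_k(𝒯_h)`. -/
def IsPiecewisePoly (k : ℕ) (v : ℝ → ℝ) : Prop :=
  ∀ i : Fin T.n, T.IsPolyOn k i v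

/-- `v` is in `P_k(𝒯_a)`, where `𝒯_a` consists of the elements having `a` as a vertex. -/
def IsPatchPoly (k : ℕ) (a : Fin (T.n + 1)) (v : ℝ → ℝ) : Prop :=
  ∀ i : Fin T.n, a ∈ T.elemVertices i → T.IsPolyOn k i v

/-- `q` is the `L²(ω a)`-orthogonal projection of `g` onto `P_k(𝒯_a)`. -/
def IsPatchProj (k : ℕ) (a : Fin (T.n + 1)) (g q : ℝ → ℝ) : Prop :=
  T.IsPatchPoly k a q ∧
    ∀ w : ℝ → ℝ, T.IsPatchPoly k a w → ip (T.pl a) (T.pr a) (fun t => g t - q t) w = 0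

/-- The `L²(ω a)`-orthogonal projection of `g ∈ L²(ω a)` onto `P_k(𝒯_a)` (unique up to null sets;
it exists by `isPatchProj_patchProj` below). -/
def patchProj (k : ℕ) (a : Fin (T.n + 1)) (g : ℝ → ℝ) : ℝ → ℝ :=
  Classical.epsilon (T.IsPatchProj k a g)

/-! ### The advection problem -/

/-- The outflow vertex for the velocity `β ≠ 0`. -/
def outflow (β : ℝ) : Fin (T.n + 1) := if 0 < β then Fin.last T.n else 0

/-- `u` solves the ultra-weak formulation `-(u, β v') = (f, v)` for all `v ∈ H¹(Ω)` vanishing at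
the outflow boundary. -/
def IsUltraWeakSolution (β : ℝ) (f u : ℝ → ℝ) : Prop :=
  IsL2 T.lo T.hi u ∧
    ∀ v g : ℝ → ℝ, IsH1 T.lo T.hi v g → v (T.x (T.outflow β)) = 0 →
      -ip T.lo T.hi u (fun t => β * g t) = ip T.lo T.hi f v

/-- The residual of `uh` vanishes on the hat functions of the interior and inflow vertices. -/
def HatOrthogonal (β : ℝ) (f uh : ℝ → ℝ) : Prop :=
  ∀ a : Fin (T.n + 1), a ≠ T.outflow β →
    ip (T.pl a) (T.pr a) f (T.hat a) +
      ip (T.pl a) (T.pr a) uh (fun t => β * deriv (T.hat a) t) = 0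

/-- `s` solves the patchwise advection-reaction problem at the vertex `a`, with trial space
`P_m(𝒯_a) ∩ H¹(ω a)` and test space `P_m(𝒯_a)`. Here `ψ_a` and `s` are polynomials on each open
element, so that `deriv` is the gradient almost everywhere. -/
def IsPatchSolution (β : ℝ) (f uh : ℝ → ℝ) (m : ℕ) (a : Fin (T.n + 1)) (s : ℝ → ℝ) : Prop :=
  T.IsPatchPoly m a s ∧ (∃ g : ℝ → ℝ, IsH1 (T.pl a) (T.pr a) s g) ∧
    ∀ w : ℝ → ℝ, T.IsPatchPoly m a w →
      ip (T.pl a) (T.pr a) (fun t => β * deriv (fun r => T.hat a r * s r) t) w =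
        ip (T.pl a) (T.pr a) (fun t => f t * T.hat a t + β * deriv (T.hat a) t * uh t) w

/-- The global reconstruction `∑_a ψ_a s_a`. -/
def reconstruction (s : Fin (T.n + 1) → ℝ → ℝ) (t : ℝ) : ℝ :=
  ∑ a, T.hat a t * s a t

/-- The Poincaré-Friedrichs constant of the patch `ω a`: the Friedrichs constant (with the value at
the outflow vertex prescribed) if `a` is the outflow vertex, the Poincaré constant otherwise. -/
def cPF (β : ℝ) (a : Fin (T.n + 1)) : ℝ :=
  if a = T.outflow β then friedrichsConst (T.pl a) (T.pr a) (T.x a)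
  else poincareConst (T.pl a) (T.pr a)

/-- `C_{cont,PF} = max_a (1 + C_{PF,ω_a} h_{ω_a} ‖∇ψ_a‖_∞)`. -/
def contPF (β : ℝ) : ℝ :=
  Finset.univ.sup' Finset.univ_nonempty
    (fun a : Fin (T.n + 1) => 1 + T.cPF β a * T.patchDiam a * T.hatGradSup a)

/-! ### Existence of the projection -/

end Mesh

theorem exists_poly_proj (lo hi : ℝ) (h : lo < hi) (k : ℕ) (g : ℝ → ℝ)
    (hg : IntervalIntegrable g volume lo hi) :
    ∃ p : Polynomial ℝ, p.natDegree ≤ k ∧ ∀ q : Polynomial ℝ, q.natDegree ≤ k →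
      ∫ t in lo..hi, (g t - p.eval t) * q.eval t = 0 := by
  have hc : ∀ p : Polynomial ℝ, Continuous fun t => p.eval t := fun p => p.continuous
  have hgi : ∀ p : Polynomial ℝ, IntervalIntegrable (fun t => g t * p.eval t) volume lo hi :=
    fun p => hg.mul_continuousOn (hc p).continuousOn
  have hpi : ∀ p q : Polynomial ℝ,
      IntervalIntegrable (fun t => p.eval t * q.eval t) volume lo hi :=
    fun p q => ((hc p).mul (hc q)).intervalIntegrable _ _
  let V := Polynomial.degreeLT ℝ (k + 1)
  have : FiniteDimensional ℝ V := Module.Finite.equiv (Polynomial.degreeLTEquiv ℝ (k + 1)).symm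
  have hV : ∀ p : Polynomial ℝ, p ∈ V ↔ p.natDegree ≤ k := by
    intro p
    rw [Polynomial.mem_degreeLT]
    constructor
    · intro hp
      by_cases h0 : p = 0
      · simp [h0]
      · rw [Polynomial.degree_eq_natDegree h0] at hp
        exact Nat.lt_succ_iff.mp (by exact_mod_cast hp)
    · intro hp
      refine lt_of_le_of_lt Polynomial.degree_le_natDegree ?_
      exact_mod_cast Nat.lt_succ_of_le hp
  let B : V →ₗ[ℝ] Module.Dual ℝ V := LinearMap.mk₂ ℝ
    (fun p q => ∫ t in lo..hi, p.1.eval t * q.1.eval t)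
    (by
      intro p p' q
      rw [← intervalIntegral.integral_add (hpi _ _) (hpi _ _)]
      congr 1; ext t; simp; ring)
    (by
      intro c p q
      rw [smul_eq_mul, ← intervalIntegral.integral_const_mul]
      congr 1; ext t; simp; ring)
    (by
      intro p q q'
      rw [← intervalIntegral.integral_add (hpi _ _) (hpi _ _)]
      congr 1; ext t; simp; ring)
    (by
      intro c p q
      rw [smul_eq_mul, ← intervalIntegral.integral_const_mul]
      congr 1; ext t; simp; ring)
  let L : Module.Dual ℝ V :=
    { toFun := fun q => ∫ t in lo..hi, g t * q.1.eval t
      map_add' := by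
        intro q q'
        rw [← intervalIntegral.integral_add (hgi _) (hgi _)]
        congr 1; ext t; simp; ring
      map_smul' := by
        intro c q
        rw [RingHom.id_apply, smul_eq_mul, ← intervalIntegral.integral_const_mul]
        congr 1; ext t; simp; ring }
  have hinj : Function.Injective B := by
    rw [injective_iff_map_eq_zero]
    intro p hp
    have h0 : ∫ t in lo..hi, p.1.eval t * p.1.eval t = 0 := congrArg (fun F => F p) hp
    by_contra hne
    have hne' : p.1 ≠ 0 := fun h' => hne (Subtype.ext h')
    obtain ⟨c, hcI, hcr⟩ : ∃ c ∈ Icc lo hi, p.1.eval c ≠ 0 := by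
      by_contra hcon
      push Not at hcon
      exact hne' (Polynomial.eq_zero_of_infinite_isRoot _
        ((Icc_infinite h).mono fun c hc' => hcon c hc'))
    have := intervalIntegral.integral_pos h
      (((hc p.1).mul (hc p.1)).continuousOn) (fun t _ => mul_self_nonneg (p.1.eval t))
      ⟨c, hcI, mul_self_pos.mpr hcr⟩
    exact this.ne' h0
  have hsurj : Function.Surjective B :=
    (LinearMap.injective_iff_surjective_of_finrank_eq_finrank
      (Subspace.dual_finrank_eq).symm).1 hinj
  obtain ⟨p, hp⟩ := hsurj L
  refine ⟨p.1, (hV _).1 p.2, fun q hq => ?_⟩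
  have h1 : ∫ t in lo..hi, p.1.eval t * q.eval t = ∫ t in lo..hi, g t * q.eval t :=
    congrArg (fun F => F ⟨q, (hV q).2 hq⟩) hp
  have h2 : ∀ t, (g t - p.1.eval t) * q.eval t = g t * q.eval t - p.1.eval t * q.eval t :=
    fun t => by ring
  simp only [h2]
  rw [intervalIntegral.integral_sub (hgi _) (hpi _ _), h1, sub_self]

namespace Mesh

variable (T : Mesh)

theorem exists_patchProj (k : ℕ) (a : Fin (T.n + 1)) (g : ℝ → ℝ)
    (hg : IsL2 (T.pl a) (T.pr a) g) : ∃ q, T.IsPatchProj k a g q := by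
  classical
  have hla : T.pl a ≤ T.x a := T.strictMono.monotone (by simp [Fin.le_def])
  have har : T.x a ≤ T.pr a := T.strictMono.monotone (by
    have := a.2
    simp only [Fin.le_def]; omega)
  have hg1 : IntervalIntegrable g volume (T.pl a) (T.pr a) := by
    rw [intervalIntegrable_iff_integrableOn_Ioo_of_le (hla.trans har)]
    exact hg.integrable (by norm_num)
  have hgl : IntervalIntegrable g volume (T.pl a) (T.x a) :=
    hg1.mono_set (by
      rw [uIcc_of_le hla, uIcc_of_le (hla.trans har)]; exact Icc_subset_Icc le_rfl har)
  have hgr : IntervalIntegrable g volume (T.x a) (T.pr a) :=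
    hg1.mono_set (by
      rw [uIcc_of_le har, uIcc_of_le (hla.trans har)]; exact Icc_subset_Icc hla le_rfl)
  -- the projection on a possibly degenerate interval
  have key : ∀ c d : ℝ, c ≤ d → IntervalIntegrable g volume c d →
      ∃ p : Polynomial ℝ, p.natDegree ≤ k ∧ ∀ q : Polynomial ℝ, q.natDegree ≤ k →
        ∫ t in c..d, (g t - p.eval t) * q.eval t = 0 := by
    intro c d hcd hi
    rcases hcd.lt_or_eq with h | h
    · exact exists_poly_proj c d h k g hi
    · exact ⟨0, by simp, fun q _ => by rw [h, intervalIntegral.integral_same]⟩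
  obtain ⟨p₁, hd₁, ho₁⟩ := key _ _ hla hgl
  obtain ⟨p₂, hd₂, ho₂⟩ := key _ _ har hgr
  refine ⟨fun t => if t < T.x a then p₁.eval t else p₂.eval t, ?_, ?_⟩
  · intro i hi
    simp only [elemVertices, Finset.mem_insert, Finset.mem_singleton] at hi
    rcases hi with hi | hi
    · refine ⟨p₂, hd₂, fun t ht => ?_⟩
      rw [← hi] at ht
      simp [ht.1.le]
    · refine ⟨p₁, hd₁, fun t ht => ?_⟩
      rw [← hi] at ht
      simp [ht.2]
  · intro w hw
    -- each half of the patch is either empty or an element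
    have hwl : ∃ r : Polynomial ℝ, r.natDegree ≤ k ∧
        ∀ t ∈ Ioo (T.pl a) (T.x a), w t = r.eval t := by
      by_cases h0 : a.val = 0
      · refine ⟨0, by simp, fun t ht => ?_⟩
        have : T.pl a = T.x a := by
          unfold pl; congr 1; ext; simp [h0]
        rw [this] at ht; exact absurd (ht.1.trans ht.2) (lt_irrefl _)
      · have ha := a.2
        have hs : (⟨a.val - 1, by omega⟩ : Fin T.n).succ = a := by ext; simp; omega
        have := hw ⟨a.val - 1, by omega⟩ (by simp [elemVertices, hs])
        unfold IsPolyOn at this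
        rw [hs] at this
        exact this
    have hwr : ∃ r : Polynomial ℝ, r.natDegree ≤ k ∧
        ∀ t ∈ Ioo (T.x a) (T.pr a), w t = r.eval t := by
      by_cases h0 : a.val = T.n
      · refine ⟨0, by simp, fun t ht => ?_⟩
        have : T.pr a = T.x a := by
          unfold pr; congr 1; ext; simp [h0]
        rw [this] at ht; exact absurd (ht.1.trans ht.2) (lt_irrefl _)
      · have ha := a.2
        have hs : (⟨a.val, by omega⟩ : Fin T.n).castSucc = a := by ext; simp
        have hs' : T.x (⟨a.val, by omega⟩ : Fin T.n).succ = T.pr a := by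
          unfold pr; congr 1; ext; simp; omega
        have := hw ⟨a.val, by omega⟩ (by simp [elemVertices, hs])
        unfold IsPolyOn at this
        rw [hs, hs'] at this
        exact this
    obtain ⟨r₁, hr₁, he₁⟩ := hwl
    obtain ⟨r₂, hr₂, he₂⟩ := hwr
    have main : ∀ (c d : ℝ) (p r : Polynomial ℝ) (F : ℝ → ℝ), c ≤ d →
        IntervalIntegrable g volume c d →
        (∀ t ∈ Ioo c d, F t = (g t - p.eval t) * r.eval t) →
        IntervalIntegrable F volume c d ∧
          ∫ t in c..d, F t = ∫ t in c..d, (g t - p.eval t) * r.eval t := by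
      intro c d p r F hcd hi hF
      have hI : IntervalIntegrable (fun t => (g t - p.eval t) * r.eval t) volume c d :=
        (hi.sub (p.continuous.intervalIntegrable _ _)).mul_continuousOn
          r.continuous.continuousOn
      constructor
      · rw [intervalIntegrable_iff_integrableOn_Ioo_of_le hcd] at hI ⊢
        exact hI.congr_fun (fun t ht => (hF t ht).symm) measurableSet_Ioo
      · rw [intervalIntegral.integral_of_le hcd, intervalIntegral.integral_of_le hcd,
          integral_Ioc_eq_integral_Ioo, integral_Ioc_eq_integral_Ioo]
        exact setIntegral_congr_fun measurableSet_Ioo hF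
    obtain ⟨i₁, e₁⟩ := main _ _ p₁ r₁
      (fun t => (g t - if t < T.x a then p₁.eval t else p₂.eval t) * w t) hla hgl
      (fun t ht => by simp [ht.2, he₁ t ht])
    obtain ⟨i₂, e₂⟩ := main _ _ p₂ r₂
      (fun t => (g t - if t < T.x a then p₁.eval t else p₂.eval t) * w t) har hgr
      (fun t ht => by simp [not_lt.mpr ht.1.le, he₂ t ht])
    unfold ip
    rw [← intervalIntegral.integral_add_adjacent_intervals i₁ i₂, e₁, e₂, ho₁ r₁ hr₁, ho₂ r₂ hr₂,
      add_zero]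

theorem isPatchProj_patchProj (k : ℕ) (a : Fin (T.n + 1)) (g : ℝ → ℝ)
    (hg : IsL2 (T.pl a) (T.pr a) g) : T.IsPatchProj k a g (T.patchProj k a g) :=
  Classical.epsilon_spec (T.exists_patchProj k a g hg)

end Mesh

end Advection

end

/-! In one dimension the ultra-weak solution `u` coincides almost everywhere with the primitive `U`
of `f / β` that vanishes at the inflow vertex (`IsUltraWeakSolution.exists_primitive`). The test
space of the patch problem contains `(ψ_a s_a)'`, so the problem says exactly that `β (ψ_a s_a)' =
Π(f ψ_a) + β ψ_a' u_h` almost everywhere. Hence `z = ψ_a (U - s_a)` satisfies `β z' = (I - Π)(f ψ_a)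
+ β ψ_a' (u - u_h)`.

The bound on `z` is a duality argument (`l2norm_le_of_dual`). Take `v` with `v' = z` and integrate
by parts: `‖z‖² = -(v, z')`. The boundary terms vanish because, away from the outflow vertex,
orthogonality to the hat function forces `z = 0` at both ends of the patch, while at the outflow
vertex `v` can be chosen to vanish (`exists_dual`). The term with `u - u_h` is paid for by the
Poincaré or Friedrichs constant of the patch. The oscillation term has mean zero, so `v` may be
replaced by `v - v̄` there, and the Payne-Weinberger inequality (`IsPrimitive.poincare`) yields the
factor `h / π`.

Finally `ψ_a (u_h - s_a) = -ψ_a (u - u_h) + z` with `0 ≤ ψ_a ≤ 1`, and the two hat functions of an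
element add up to one. Uniformity of the constant follows from `C_PF ≤ 1` and `h ‖ψ_a'‖_∞ ≤ 1 +
|κ|`.

All of this is calculus with primitives of integrable functions; `IsH1.isPrimitive` and
`IsPrimitive.isH1` translate from and to weak derivatives. -/

namespace Advection

variable {a b c : ℝ} {v w g k : ℝ → ℝ}

/-! ### The scalar product and the norm of `L²(a, b)` -/

theorem ip_eq (h : a ≤ b) (v w : ℝ → ℝ) : ip a b v w = ∫ t in Ioo a b, v t * w t := by
  rw [ip, intervalIntegral.integral_of_le h, integral_Ioc_eq_integral_Ioo]

theorem intervalIntegrable_iff_Ioo (h : a ≤ b) :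
    IntervalIntegrable v volume a b ↔ Integrable v (volume.restrict (Ioo a b)) :=
  intervalIntegrable_iff_integrableOn_Ioo_of_le h

theorem IsL2.integrable_mul (hv : IsL2 a b v) (hw : IsL2 a b w) :
    Integrable (fun t => v t * w t) (volume.restrict (Ioo a b)) :=
  MemLp.integrable_mul (p := 2) (q := 2) hv hw

theorem IsL2.intervalIntegrable_mul (h : a ≤ b) (hv : IsL2 a b v) (hw : IsL2 a b w) :
    IntervalIntegrable (fun t => v t * w t) volume a b :=
  (intervalIntegrable_iff_Ioo h).2 (hv.integrable_mul hw)

theorem IsL2.intervalIntegrable (h : a ≤ b) (hv : IsL2 a b v) :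
    IntervalIntegrable v volume a b :=
  (intervalIntegrable_iff_Ioo h).2 (hv.integrable (by norm_num))

theorem IsL2.add (hv : IsL2 a b v) (hw : IsL2 a b w) : IsL2 a b (fun t => v t + w t) :=
  MemLp.add hv hw

theorem IsL2.sub (hv : IsL2 a b v) (hw : IsL2 a b w) : IsL2 a b (fun t => v t - w t) :=
  MemLp.sub hv hw

theorem IsL2.const_mul (hv : IsL2 a b v) (r : ℝ) : IsL2 a b (fun t => r * v t) :=
  MemLp.const_mul hv r

theorem IsL2.abs (hv : IsL2 a b v) : IsL2 a b (fun t => |v t|) :=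
  MemLp.abs hv

theorem IsL2.mono (hv : IsL2 a b v) {c d : ℝ} (hc : a ≤ c) (hd : d ≤ b) : IsL2 c d v :=
  MemLp.mono_measure (Measure.restrict_mono (Ioo_subset_Ioo hc hd) le_rfl) hv

theorem _root_.ContinuousOn.isL2 (hv : ContinuousOn v (Icc a b)) : IsL2 a b v := by
  obtain ⟨M, hM⟩ := isCompact_Icc.exists_bound_of_continuousOn hv
  refine MemLp.of_bound ((hv.mono Ioo_subset_Icc_self).aestronglyMeasurable measurableSet_Ioo) M ?_
  filter_upwards [ae_restrict_mem measurableSet_Ioo] with t ht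
  exact hM t (Ioo_subset_Icc_self ht)

theorem IsL2.congr (hv : IsL2 a b v) (h : ∀ᵐ t ∂volume.restrict (Ioo a b), v t = w t) :
    IsL2 a b w :=
  MemLp.ae_eq h hv

/-- A product of an `L²` function with an essentially bounded function is in `L²`. -/
theorem IsL2.bdd_mul (hv : IsL2 a b v)
    (hw : AEStronglyMeasurable w (volume.restrict (Ioo a b))) (M : ℝ)
    (hM : ∀ᵐ t ∂volume.restrict (Ioo a b), |w t| ≤ M) : IsL2 a b (fun t => w t * v t) := by
  refine MemLp.of_le_mul (c := M) hv (hw.mul hv.1) ?_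
  filter_upwards [hM] with t ht
  rw [norm_mul]
  exact mul_le_mul_of_nonneg_right ht (norm_nonneg _)

theorem IsL2.continuousOn_mul (hv : IsL2 a b v) (hw : ContinuousOn w (Icc a b)) :
    IsL2 a b (fun t => w t * v t) := by
  obtain ⟨M, hM⟩ := isCompact_Icc.exists_bound_of_continuousOn hw
  refine hv.bdd_mul ((hw.mono Ioo_subset_Icc_self).aestronglyMeasurable measurableSet_Ioo) M ?_
  filter_upwards [ae_restrict_mem measurableSet_Ioo] with t ht
  exact hM t (Ioo_subset_Icc_self ht)

theorem IsL2.trans (hab : a ≤ b) (hbc : b ≤ c) (h₁ : IsL2 a b v) (h₂ : IsL2 b c v) :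
    IsL2 a c v := by
  unfold IsL2 at *
  rw [restrict_Ioo_eq_restrict_Ioc] at *
  have hm : AEStronglyMeasurable v (volume.restrict (Ioc a c)) := by
    rw [← Ioc_union_Ioc_eq_Ioc hab hbc, aestronglyMeasurable_union_iff]
    exact ⟨h₁.1, h₂.1⟩
  rw [memLp_two_iff_integrable_sq hm, ← Ioc_union_Ioc_eq_Ioc hab hbc]
  exact IntegrableOn.union ((memLp_two_iff_integrable_sq h₁.1).1 h₁)
    ((memLp_two_iff_integrable_sq h₂.1).1 h₂)

theorem ip_self_nonneg (h : a ≤ b) (v : ℝ → ℝ) : 0 ≤ ip a b v v := by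
  rw [ip_eq h]
  exact integral_nonneg fun t => mul_self_nonneg _

theorem l2norm_nonneg (a b : ℝ) (v : ℝ → ℝ) : 0 ≤ l2norm a b v := Real.sqrt_nonneg _

theorem l2norm_sq (h : a ≤ b) (v : ℝ → ℝ) : l2norm a b v ^ 2 = ip a b v v :=
  Real.sq_sqrt (ip_self_nonneg h v)

theorem ip_congr (h : a ≤ b) {v' w' : ℝ → ℝ}
    (hv : ∀ᵐ t ∂volume.restrict (Ioo a b), v t * w t = v' t * w' t) :
    ip a b v w = ip a b v' w' := by
  rw [ip_eq h, ip_eq h]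
  exact integral_congr_ae hv

/-- Cauchy-Schwarz: the quadratic `x ↦ ‖v + x w‖²` is nonnegative, so its discriminant is at most
zero. -/
theorem abs_ip_le (h : a ≤ b) (hv : IsL2 a b v) (hw : IsL2 a b w) :
    |ip a b v w| ≤ l2norm a b v * l2norm a b w := by
  have key : ∀ x : ℝ, 0 ≤ ip a b w w * (x * x) + 2 * ip a b v w * x + ip a b v v := by
    intro x
    have h0 := ip_self_nonneg h (fun t => v t + x * w t)
    have : ip a b (fun t => v t + x * w t) (fun t => v t + x * w t) =
        ip a b w w * (x * x) + 2 * ip a b v w * x + ip a b v v := by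
      simp only [ip_eq h]
      have e : ∀ t, (v t + x * w t) * (v t + x * w t) =
          (x * x) * (w t * w t) + (2 * x) * (v t * w t) + v t * v t := fun t => by ring
      simp only [e]
      have i₁ := (hw.integrable_mul hw).const_mul (x * x)
      have i₂ := (hv.integrable_mul hw).const_mul (2 * x)
      have i₃ : Integrable (fun t => x * x * (w t * w t) + 2 * x * (v t * w t))
          (volume.restrict (Ioo a b)) := i₁.add i₂
      rw [integral_add i₃ (hv.integrable_mul hv), integral_add i₁ i₂,
        integral_const_mul, integral_const_mul]
      ring
    rwa [this] at h0
  have hd := discrim_le_zero key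
  unfold discrim at hd
  refine abs_le_of_sq_le_sq ?_ (mul_nonneg (l2norm_nonneg ..) (l2norm_nonneg ..))
  rw [mul_pow, l2norm_sq h, l2norm_sq h]
  nlinarith

theorem l2norm_add_le (h : a ≤ b) (hv : IsL2 a b v) (hw : IsL2 a b w) :
    l2norm a b (fun t => v t + w t) ≤ l2norm a b v + l2norm a b w := by
  refine Real.sqrt_le_iff.2 ⟨add_nonneg (l2norm_nonneg ..) (l2norm_nonneg ..), ?_⟩
  have hcs := (le_abs_self _).trans (abs_ip_le h hv hw)
  have : ip a b (fun t => v t + w t) (fun t => v t + w t) =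
      ip a b v v + 2 * ip a b v w + ip a b w w := by
    simp only [ip_eq h]
    have e : ∀ t, (v t + w t) * (v t + w t) = v t * v t + 2 * (v t * w t) + w t * w t :=
      fun t => by ring
    simp only [e]
    have i₂ := (hv.integrable_mul hw).const_mul 2
    have i₃ : Integrable (fun t => v t * v t + 2 * (v t * w t))
        (volume.restrict (Ioo a b)) := (hv.integrable_mul hv).add i₂
    rw [integral_add i₃ (hw.integrable_mul hw),
      integral_add (hv.integrable_mul hv) i₂, integral_const_mul]
  rw [this, ← l2norm_sq h, ← l2norm_sq h]
  nlinarith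

theorem l2norm_le_of_abs_le (h : a ≤ b) (hw : IsL2 a b w)
    (hvw : ∀ᵐ t ∂volume.restrict (Ioo a b), |v t| ≤ |w t|) : l2norm a b v ≤ l2norm a b w := by
  refine Real.sqrt_le_sqrt ?_
  rw [ip_eq h, ip_eq h]
  refine integral_mono_of_nonneg (Filter.Eventually.of_forall fun t => mul_self_nonneg _)
    (hw.integrable_mul hw) ?_
  filter_upwards [hvw] with t ht
  exact abs_le_iff_mul_self_le.1 ht

theorem l2norm_congr (h : a ≤ b) (hvw : ∀ᵐ t ∂volume.restrict (Ioo a b), v t = w t) :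
    l2norm a b v = l2norm a b w := by
  unfold l2norm
  rw [ip_congr h]
  filter_upwards [hvw] with t ht
  rw [ht]

theorem l2norm_mono (hv : IsL2 a b v) {c d : ℝ} (hc : a ≤ c) (hcd : c ≤ d) (hd : d ≤ b) :
    l2norm c d v ≤ l2norm a b v := by
  refine Real.sqrt_le_sqrt ?_
  rw [ip_eq hcd, ip_eq (hc.trans (hcd.trans hd))]
  exact setIntegral_mono_set (hv.integrable_mul hv)
    (Filter.Eventually.of_forall fun t => mul_self_nonneg _)
    (Ioo_subset_Ioo hc hd).eventuallyLE

theorem l2norm_abs (a b : ℝ) (v : ℝ → ℝ) : l2norm a b (fun t => |v t|) = l2norm a b v := by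
  simp only [l2norm, ip, abs_mul_abs_self]

theorem l2norm_const_mul (a b r : ℝ) (v : ℝ → ℝ) :
    l2norm a b (fun t => r * v t) = |r| * l2norm a b v := by
  have : ip a b (fun t => r * v t) (fun t => r * v t) = r ^ 2 * ip a b v v := by
    simp only [ip, ← intervalIntegral.integral_const_mul]
    congr 1; ext t; ring
  rw [l2norm, this, Real.sqrt_mul (sq_nonneg r), Real.sqrt_sq_eq_abs, l2norm]

theorem ae_eq_zero_of_ip_self (h : a ≤ b) (hv : IsL2 a b v) (h0 : ip a b v v = 0) :
    ∀ᵐ t ∂volume.restrict (Ioo a b), v t = 0 := by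
  rw [ip_eq h, integral_eq_zero_iff_of_nonneg (fun t => mul_self_nonneg _)
    (hv.integrable_mul hv)] at h0
  filter_upwards [h0] with t ht
  exact mul_self_eq_zero.1 ht

/-! ### Primitives of integrable functions -/

/-- `v` is a primitive on `[a, b]` of the integrable function `g`. -/
def IsPrimitive (a b : ℝ) (v g : ℝ → ℝ) : Prop :=
  IntervalIntegrable g volume a b ∧ ∀ t ∈ Icc a b, v t = v a + ∫ r in a..t, g r

/-- The free base point `c` allows normalisation at either end of the domain or at the vertex of a
patch. -/
theorem _root_.IntervalIntegrable.isPrimitive (h : a ≤ b) (hg : IntervalIntegrable g volume a b)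
    (hc : c ∈ Icc a b) (r : ℝ) : IsPrimitive a b (fun t => r + ∫ s in c..t, g s) g := by
  refine ⟨hg, fun t ht => ?_⟩
  have h₁ : IntervalIntegrable g volume c a :=
    hg.mono_set (by rw [uIcc_of_le h, uIcc_of_ge hc.1]; exact Icc_subset_Icc le_rfl hc.2)
  have h₂ : IntervalIntegrable g volume a t :=
    hg.mono_set (by rw [uIcc_of_le h, uIcc_of_le ht.1]; exact Icc_subset_Icc le_rfl ht.2)
  simp only
  rw [← intervalIntegral.integral_add_adjacent_intervals h₁ h₂]
  ring

namespace IsPrimitive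

theorem continuousOn (hv : IsPrimitive a b v g) (h : a ≤ b) : ContinuousOn v (Icc a b) := by
  have := intervalIntegral.continuousOn_primitive_interval' hv.1 left_mem_uIcc
  rw [uIcc_of_le h] at this
  exact (continuousOn_const.add this).congr hv.2

theorem sub_eq (hv : IsPrimitive a b v g) (h : a ≤ b) : v b - v a = ∫ t in a..b, g t := by
  rw [hv.2 b (right_mem_Icc.2 h)]; ring

theorem mono (hv : IsPrimitive a b v g) {c d : ℝ} (hc : a ≤ c) (hcd : c ≤ d) (hd : d ≤ b) :
    IsPrimitive c d v g := by
  have i : ∀ t ∈ Icc a b, ∀ s ∈ Icc a b, IntervalIntegrable g volume s t := fun t ht s hs =>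
    hv.1.mono_set (by
      rw [uIcc_of_le (hc.trans (hcd.trans hd))]
      exact uIcc_subset_Icc hs ht)
  have hcm : c ∈ Icc a b := ⟨hc, hcd.trans hd⟩
  refine ⟨i d ⟨hc.trans hcd, hd⟩ c hcm, fun t ht => ?_⟩
  have htm : t ∈ Icc a b := ⟨hc.trans ht.1, ht.2.trans hd⟩
  have ham : a ∈ Icc a b := ⟨le_rfl, hc.trans (hcd.trans hd)⟩
  rw [hv.2 t htm, hv.2 c hcm,
    ← intervalIntegral.integral_add_adjacent_intervals (i c hcm a ham) (i t htm c hcm)]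
  ring

/-- Gluing works because both pieces share the value `v b`; this is how continuity across a vertex
is used. -/
theorem trans (h₁ : IsPrimitive a b v g) (h₂ : IsPrimitive b c v g) (hab : a ≤ b) :
    IsPrimitive a c v g := by
  refine ⟨h₁.1.trans h₂.1, fun t ht => ?_⟩
  rcases le_total t b with h | h
  · exact h₁.2 t ⟨ht.1, h⟩
  · have : IntervalIntegrable g volume b t :=
      h₂.1.mono_set (by
        rw [uIcc_of_le h, uIcc_of_le (h.trans ht.2)]; exact Icc_subset_Icc le_rfl ht.2)
    rw [h₂.2 t ⟨h, ht.2⟩, h₁.2 b ⟨hab, le_rfl⟩,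
      ← intervalIntegral.integral_add_adjacent_intervals h₁.1 this]
    ring

theorem congr_left (hv : IsPrimitive a b v g) (h : a ≤ b) (hw : ∀ t ∈ Icc a b, w t = v t) :
    IsPrimitive a b w g :=
  ⟨hv.1, fun t ht => by rw [hw t ht, hw a (left_mem_Icc.2 h)]; exact hv.2 t ht⟩

theorem congr_right (hv : IsPrimitive a b v g) (h : a ≤ b)
    (hk : ∀ᵐ t ∂volume.restrict (Ioo a b), g t = k t) : IsPrimitive a b v k := by
  refine ⟨?_, fun t ht => ?_⟩
  · have := hv.1
    rw [intervalIntegrable_iff_Ioo h] at this ⊢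
    exact this.congr hk
  · rw [hv.2 t ht]
    congr 1
    rw [intervalIntegral.integral_of_le ht.1, intervalIntegral.integral_of_le ht.1,
      integral_Ioc_eq_integral_Ioo, integral_Ioc_eq_integral_Ioo]
    exact integral_congr_ae
      (ae_mono (Measure.restrict_mono (Ioo_subset_Ioo le_rfl ht.2) le_rfl) hk)

theorem sub (hv : IsPrimitive a b v g) (hw : IsPrimitive a b w k) :
    IsPrimitive a b (fun t => v t - w t) (fun t => g t - k t) := by
  refine ⟨hv.1.sub hw.1, fun t ht => ?_⟩
  have hs : uIcc a t ⊆ uIcc a b := by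
    rw [uIcc_of_le ht.1, uIcc_of_le (ht.1.trans ht.2)]; exact Icc_subset_Icc le_rfl ht.2
  rw [intervalIntegral.integral_sub (hv.1.mono_set hs) (hw.1.mono_set hs)]
  linear_combination hv.2 t ht - hw.2 t ht

theorem sub_const (hv : IsPrimitive a b v g) (r : ℝ) :
    IsPrimitive a b (fun t => v t - r) g :=
  ⟨hv.1, fun t ht => by linear_combination hv.2 t ht⟩

/-- The product rule. -/
theorem mul (hv : IsPrimitive a b v g) (hw : IsPrimitive a b w k) (h : a ≤ b) :
    IsPrimitive a b (fun t => v t * w t) (fun t => g t * w t + v t * k t) := by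
  have huI := uIcc_of_le h
  refine ⟨(hv.1.mul_continuousOn (huI ▸ hw.continuousOn h)).add
    (hw.1.continuousOn_mul (huI ▸ hv.continuousOn h)), fun t ht => ?_⟩
  have hs : uIcc a t ⊆ uIcc a b := by
    rw [huI, uIcc_of_le ht.1]; exact Icc_subset_Icc le_rfl ht.2
  -- Absolute continuity and the derivative are established for the explicit expression `v a + ∫ g`,
  -- which agrees with `v` on `[a, b]`; off that interval `v` is arbitrary.
  have hac : ∀ {v g : ℝ → ℝ}, IsPrimitive a b v g →
      AbsolutelyContinuousOnInterval (fun x => v a + ∫ r in a..x, g r) a t := fun {v g} hv => by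
    have h₀ : AbsolutelyContinuousOnInterval (fun _ : ℝ => v a) a t :=
      ContDiffOn.absolutelyContinuousOnInterval contDiffOn_const
    have h₁ : AbsolutelyContinuousOnInterval (fun x => ∫ r in a..x, g r) a t :=
      (hv.1.mono_set hs).absolutelyContinuousOnInterval_intervalIntegral (by simp)
    exact h₀.fun_add h₁
  have hder : ∀ {v g : ℝ → ℝ}, IsPrimitive a b v g → ∀ᵐ x : ℝ, x ∈ uIoc a t →
      deriv (fun x => v a + ∫ r in a..x, g r) x = g x := fun {v g} hv => by
    filter_upwards [hv.1.ae_hasDerivAt_integral] with x hx hxt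
    exact ((hx (hs (uIoc_subset_uIcc hxt)) a (by simp)).const_add _).deriv
  have key := (hac hv).integral_deriv_mul_eq_sub (hac hw)
  simp only [intervalIntegral.integral_same, add_zero] at key
  rw [← hv.2 t ht, ← hw.2 t ht] at key
  have : ∫ x in a..t, (g x * w x + v x * k x) = v t * w t - v a * w a := by
    rw [← key]
    refine intervalIntegral.integral_congr_ae ?_
    filter_upwards [hder hv, hder hw] with x h₁ h₂ hx
    have hxI : x ∈ Icc a b := by
      rw [← huI]; exact hs (uIoc_subset_uIcc hx)
    rw [h₁ hx, h₂ hx, ← hv.2 x hxI, ← hw.2 x hxI]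
  rw [this]; ring

/-- Integration by parts. -/
theorem integral_mul_eq (hv : IsPrimitive a b v g) (hw : IsPrimitive a b w k) (h : a ≤ b) :
    ip a b g w = v b * w b - v a * w a - ip a b v k := by
  have huI := uIcc_of_le h
  rw [(hv.mul hw h).sub_eq h, intervalIntegral.integral_add
    (hv.1.mul_continuousOn (huI ▸ hw.continuousOn h))
    (hw.1.continuousOn_mul (huI ▸ hv.continuousOn h))]
  simp [ip]

theorem of_hasDerivAt (hv : ∀ t, HasDerivAt v (g t) t) (hg : Continuous g) (a b : ℝ) :
    IsPrimitive a b v g :=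
  ⟨hg.intervalIntegrable _ _, fun t _ => by
    rw [intervalIntegral.integral_eq_sub_of_hasDerivAt (fun x _ => hv x)
      (hg.intervalIntegrable _ _)]; ring⟩

theorem polynomial (p : Polynomial ℝ) (a b : ℝ) :
    IsPrimitive a b (fun t => p.eval t) (fun t => p.derivative.eval t) :=
  of_hasDerivAt (fun t => p.hasDerivAt t) p.derivative.continuous a b

end IsPrimitive

/-! ### `H¹` functions are the primitives of `L²` functions -/

theorem eq_zero_of_tsupport_subset {φ : ℝ → ℝ} (h : tsupport φ ⊆ Ioo a b) :
    φ a = 0 ∧ φ b = 0 :=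
  ⟨image_eq_zero_of_notMem_tsupport fun ha => lt_irrefl _ (h ha).1,
    image_eq_zero_of_notMem_tsupport fun hb => lt_irrefl _ (h hb).2⟩

theorem _root_.ContDiff.isPrimitive {φ : ℝ → ℝ} (hφ : ContDiff ℝ ∞ φ) (a b : ℝ) :
    IsPrimitive a b φ (deriv φ) :=
  .of_hasDerivAt (fun t => (hφ.differentiable (by simp) t).hasDerivAt)
    (hφ.continuous_deriv (by simp)) a b

theorem IsPrimitive.hasWeakDeriv (hv : IsPrimitive a b v g) (h : a ≤ b) :
    HasWeakDeriv a b v g := by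
  intro φ hφ _ hs
  obtain ⟨h₁, h₂⟩ := eq_zero_of_tsupport_subset hs
  have := hv.integral_mul_eq (hφ.isPrimitive a b) h
  simp only [h₁, h₂, ip] at this
  linarith

theorem IsPrimitive.isH1 (hv : IsPrimitive a b v g) (h : a ≤ b) (hg : IsL2 a b g) :
    IsH1 a b v g :=
  ⟨hv.continuousOn h, hg, hv.hasWeakDeriv h⟩

theorem exists_Icc_of_isCompact {K : Set ℝ} (hK : IsCompact K) (hne : K.Nonempty)
    (h : K ⊆ Ioo a b) : ∃ p q, a < p ∧ q < b ∧ K ⊆ Icc p q := by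
  obtain ⟨p, hp⟩ := hK.exists_isLeast hne
  obtain ⟨q, hq⟩ := hK.exists_isGreatest hne
  exact ⟨p, q, (h hp.1).1, (h hq.1).2, fun t ht => ⟨hp.2 ht, hq.2 ht⟩⟩

/-- A test function with vanishing integral is the derivative of a test function. -/
theorem exists_test_primitive {θ : ℝ → ℝ} (hθ : ContDiff ℝ ∞ θ) {p q : ℝ} (hp : a < p)
    (hq : q < b) (hs : ∀ t, t ∉ Icc p q → θ t = 0) (h0 : ∫ t in a..b, θ t = 0) :
    ∃ φ : ℝ → ℝ, ContDiff ℝ ∞ φ ∧ HasCompactSupport φ ∧ tsupport φ ⊆ Ioo a b ∧ deriv φ = θ := by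
  have hd : ∀ t, HasDerivAt (fun t => ∫ r in a..t, θ r) (θ t) t := fun t =>
    intervalIntegral.integral_hasDerivAt_right (hθ.continuous.intervalIntegrable _ _)
      hθ.continuous.stronglyMeasurable.stronglyMeasurableAtFilter hθ.continuous.continuousAt
  have hderiv : deriv (fun t => ∫ r in a..t, θ r) = θ := funext fun t => (hd t).deriv
  have hsub : tsupport (fun t => ∫ r in a..t, θ r) ⊆ Icc p q := by
    refine closure_minimal (fun t ht => ?_) isClosed_Icc
    by_contra hcon
    refine ht ?_
    simp only
    -- Left of `p` the integrand is zero; right of `q` the integral already has its full value,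
    -- which is zero.
    rcases lt_or_ge t p with h | h
    · refine (intervalIntegral.integral_congr (g := fun _ => (0 : ℝ)) fun r hr => hs r ?_).trans
        (by simp)
      intro hr'
      have := hr.2.trans_lt (max_lt hp h)
      exact absurd hr'.1 (not_le.2 this)
    · have h' : q < t := by
        by_contra hle
        exact hcon ⟨h, not_lt.1 hle⟩
      have : ∫ r in t..b, θ r = 0 := by
        refine (intervalIntegral.integral_congr (g := fun _ => (0 : ℝ)) fun r hr => hs r ?_).trans
          (by simp)
        intro hr'
        have := (lt_min h' hq).trans_le hr.1
        exact absurd hr'.2 (not_le.2 this)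
      rw [← intervalIntegral.integral_add_adjacent_intervals
        (hθ.continuous.intervalIntegrable a t) (hθ.continuous.intervalIntegrable t b), this,
        add_zero] at h0
      exact h0
  refine ⟨_, ?_, isCompact_Icc.of_isClosed_subset (isClosed_tsupport _) hsub,
    hsub.trans (Icc_subset_Ioo hp hq), hderiv⟩
  rw [contDiff_infty_iff_deriv, hderiv]
  exact ⟨fun t => (hd t).differentiableAt, hθ⟩

/-- The lemma of du Bois-Reymond. -/
theorem eq_const_of_hasWeakDeriv_zero (h : a < b) (hw : ContinuousOn w (Icc a b))
    (h0 : HasWeakDeriv a b w fun _ => 0) : ∃ r, ∀ t ∈ Icc a b, w t = r := by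
  have hmid : (a + b) / 2 ∈ Ioo a b := ⟨by linarith, by linarith⟩
  let B : ContDiffBump ((a + b) / 2) := ⟨(b - a) / 8, (b - a) / 4, by linarith, by linarith⟩
  have hBs : tsupport B ⊆ Ioo a b := by
    rw [B.tsupport_eq, Real.closedBall_eq_Icc]
    intro t ht
    have h₁ : B.rOut = (b - a) / 4 := rfl
    rw [h₁] at ht
    exact ⟨by linarith [ht.1], by linarith [ht.2]⟩
  have hBc : ContDiff ℝ ∞ B := B.contDiff
  have hBm : (a + b) / 2 ∈ tsupport B :=
    subset_tsupport _ (by simp [B.support_eq, B.rOut_pos])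
  set N := ∫ t in a..b, B t with hN
  have hNpos : 0 < N :=
    intervalIntegral.integral_pos h hBc.continuous.continuousOn (fun t _ => B.nonneg)
      ⟨_, Ioo_subset_Icc_self hmid, by
        rw [B.one_of_mem_closedBall (Metric.mem_closedBall_self B.rIn_pos.le)]; exact one_pos⟩
  have hwi : ∀ η : ℝ → ℝ, Continuous η → IntervalIntegrable (fun t => w t * η t) volume a b :=
    fun η hη => (hw.mul hη.continuousOn).intervalIntegrable_of_Icc h.le
  have key : ∀ η : ℝ → ℝ, ContDiff ℝ ∞ η → HasCompactSupport η → tsupport η ⊆ Ioo a b →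
      ∫ t in a..b, η t * (w t - (∫ t in a..b, w t * B t) / N) = 0 := by
    intro η hη hηc hηs
    obtain ⟨p, q, hp, hq, hK⟩ := exists_Icc_of_isCompact (hηc.union B.hasCompactSupport)
      ⟨_, Or.inr hBm⟩ (union_subset hηs hBs)
    -- Subtracting the right multiple of the bump `B` makes the integral of `η` vanish, so the
    -- difference is the derivative of an admissible test function.
    obtain ⟨φ, h₁, h₂, h₃, h₄⟩ := exists_test_primitive (a := a) (b := b)
      (θ := fun t => η t - (∫ t in a..b, η t) / N * B t) (hη.sub (contDiff_const.mul hBc)) hp hq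
      (fun t ht => by
        rw [image_eq_zero_of_notMem_tsupport fun h' => ht (hK (Or.inl h')),
          image_eq_zero_of_notMem_tsupport (f := B) fun h' => ht (hK (Or.inr h'))]
        simp)
      (by
        rw [intervalIntegral.integral_sub (hη.continuous.intervalIntegrable _ _)
          ((hBc.continuous.const_mul _).intervalIntegrable _ _),
          intervalIntegral.integral_const_mul, ← hN, div_mul_cancel₀ _ hNpos.ne', sub_self])
    have h5 := h0 φ h₁ h₂ h₃
    rw [h₄] at h5
    have e₁ : ∀ t, w t * (η t - (∫ t in a..b, η t) / N * B t) =
        w t * η t - (∫ t in a..b, η t) / N * (w t * B t) := fun t => by ring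
    simp only [e₁, zero_mul, intervalIntegral.integral_zero, neg_zero] at h5
    rw [intervalIntegral.integral_sub (hwi _ hη.continuous) ((hwi _ hBc.continuous).const_mul _),
      intervalIntegral.integral_const_mul] at h5
    have e₂ : ∀ t, η t * (w t - (∫ t in a..b, w t * B t) / N) =
        w t * η t - (∫ t in a..b, w t * B t) / N * η t := fun t => by ring
    simp only [e₂]
    rw [intervalIntegral.integral_sub (hwi _ hη.continuous)
      ((hη.continuous.intervalIntegrable _ _).const_mul _), intervalIntegral.integral_const_mul,
      ← h5]
    ring
  refine ⟨(∫ t in a..b, w t * B t) / N, ?_⟩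
  have hae : ∀ᵐ t, t ∈ Ioo a b → w t - (∫ t in a..b, w t * B t) / N = 0 := by
    refine isOpen_Ioo.ae_eq_zero_of_integral_contDiff_smul_eq_zero
      (((hw.mono Ioo_subset_Icc_self).sub continuousOn_const).locallyIntegrableOn
        measurableSet_Ioo) fun η h₁ h₂ h₃ => ?_
    have := key η h₁ h₂ h₃
    rw [intervalIntegral.integral_of_le h.le, integral_Ioc_eq_integral_Ioo] at this
    rw [← this, setIntegral_eq_integral_of_forall_compl_eq_zero]
    · simp
    · intro t ht
      rw [image_eq_zero_of_notMem_tsupport fun h' => ht (h₃ h'), zero_mul]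
  -- Continuity turns almost everywhere equality on the open interval into equality on the closed
  -- one.
  refine Measure.eqOn_Icc_of_ae_eq volume h.ne ?_ hw continuousOn_const
  rw [← restrict_Ioo_eq_restrict_Icc]
  refine (ae_restrict_iff' measurableSet_Ioo).2 (hae.mono fun t ht hm => ?_)
  linarith [ht hm]

/-- The difference of `v` and `∫ g` is continuous with weak derivative zero, hence constant by du
Bois-Reymond. -/
theorem IsH1.isPrimitive (hv : IsH1 a b v g) (h : a < b) : IsPrimitive a b v g := by
  have hi := hv.memLp_deriv.intervalIntegrable h.le
  have hP := hi.isPrimitive h.le (left_mem_Icc.2 h.le) 0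
  have hPc := hP.continuousOn h.le
  obtain ⟨r, hr⟩ := eq_const_of_hasWeakDeriv_zero h (hv.continuousOn.sub hPc) (by
    intro φ h₁ h₂ h₃
    have e₁ := hv.weakDeriv φ h₁ h₂ h₃
    have e₂ := hP.hasWeakDeriv h.le φ h₁ h₂ h₃
    have hd : Continuous (deriv φ) := h₁.continuous_deriv (by simp)
    have e₃ : ∀ t, (v t - (0 + ∫ s in a..t, g s)) * deriv φ t =
      v t * deriv φ t - (0 + ∫ s in a..t, g s) * deriv φ t := fun t => by ring
    simp only [Pi.sub_apply, e₃]
    have i₁ : IntervalIntegrable (fun t => v t * deriv φ t) volume a b :=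
      (hv.continuousOn.mul hd.continuousOn).intervalIntegrable_of_Icc h.le
    have i₂ : IntervalIntegrable (fun t => (0 + ∫ s in a..t, g s) * deriv φ t) volume a b :=
      (hPc.mul hd.continuousOn).intervalIntegrable_of_Icc h.le
    rw [intervalIntegral.integral_sub i₁ i₂, e₁, e₂]
    simp)
  refine ⟨hi, fun t ht => ?_⟩
  have h₁ := hr t ht
  have h₂ := hr a (left_mem_Icc.2 h.le)
  simp only [Pi.sub_apply, intervalIntegral.integral_same] at h₁ h₂
  linarith

/-! ### The Poincaré and Friedrichs inequalities -/

/-- The Friedrichs inequality for functions vanishing at both end points. -/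
theorem wirtinger {M : ℝ} (h : a < b) {p : ℝ → ℝ} (hw : ContinuousOn w (Icc a b))
    (hd : ∀ t ∈ Ioo a b, HasDerivAt w (p t) t) (hp : ContinuousOn p (Icc a b))
    (h₁ : ∀ t ∈ Icc a b, |w t| ≤ M * (t - a)) (h₂ : ∀ t ∈ Icc a b, |w t| ≤ M * (b - t)) :
    Real.pi / (b - a) * l2norm a b w ≤ l2norm a b p := by
  have hpi := Real.pi_pos
  have hba : 0 < b - a := sub_pos.2 h
  set κ := Real.pi / (b - a) with hκ
  have hκpos : 0 < κ := by positivity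
  have hκb : κ * (b - a) = Real.pi := by rw [hκ]; field_simp
  have hM : 0 ≤ M := by
    have := (abs_nonneg _).trans (h₁ b (right_mem_Icc.2 h.le))
    exact nonneg_of_mul_nonneg_left this hba
  have hsin : ∀ t ∈ Ioo a b, 0 < Real.sin (κ * (t - a)) := fun t ht => by
    refine Real.sin_pos_of_pos_of_lt_pi (mul_pos hκpos (sub_pos.2 ht.1)) ?_
    rw [← hκb]
    exact mul_lt_mul_of_pos_left (by linarith [ht.2]) hκpos
  -- Jacobi's trick: with `F = κ w² cot(κ(t - a))`, the difference `p² - κ² w² - F'` is the perfect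
  -- square `(p - κ w cot)²`. As `F` vanishes at both ends, integration gives the sharp inequality.
  let F : ℝ → ℝ := fun t => κ * w t ^ 2 * Real.cos (κ * (t - a)) / Real.sin (κ * (t - a))
  have hwa : w a = 0 := by simpa using h₁ a (left_mem_Icc.2 h.le)
  have hwb : w b = 0 := by simpa using h₂ b (right_mem_Icc.2 h.le)
  -- The linear decay of `w` at the ends compensates the zeros of the sine, by Jordan's inequality
  -- `sin x ≥ 2 x / π`; this makes `F` continuous up to the ends.
  have hFb : ∀ t ∈ Icc a b, |F t| ≤ M * Real.pi / 2 * |w t| := by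
    intro t ht
    rcases eq_or_ne (w t) 0 with h0 | h0
    · simp [F, h0]
    have ht' : t ∈ Ioo a b :=
      ⟨lt_of_le_of_ne ht.1 fun e => h0 (e ▸ hwa), lt_of_le_of_ne ht.2 fun e => h0 (e ▸ hwb)⟩
    have hs := hsin t ht'
    have hq : κ * |w t| ≤ M * Real.pi / 2 * Real.sin (κ * (t - a)) := by
      rcases le_total (κ * (t - a)) (Real.pi / 2) with hc | hc
      · have := Real.mul_le_sin (mul_nonneg hκpos.le (sub_nonneg.2 ht.1)) hc
        calc κ * |w t| ≤ κ * (M * (t - a)) := by gcongr; exact h₁ t ht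
          _ = M * Real.pi / 2 * (2 / Real.pi * (κ * (t - a))) := by field_simp
          _ ≤ _ := by gcongr
      · have e : Real.pi - κ * (t - a) = κ * (b - t) := by rw [← hκb]; ring
        have := Real.mul_le_sin (x := κ * (b - t))
          (mul_nonneg hκpos.le (sub_nonneg.2 ht.2)) (by rw [← e]; linarith)
        rw [← e, Real.sin_pi_sub, e] at this
        calc κ * |w t| ≤ κ * (M * (b - t)) := by gcongr; exact h₂ t ht
          _ = M * Real.pi / 2 * (2 / Real.pi * (κ * (b - t))) := by field_simp
          _ ≤ _ := by gcongr
    have hc := Real.abs_cos_le_one (κ * (t - a))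
    simp only [F]
    rw [abs_div, abs_mul, abs_mul, abs_of_pos hκpos, abs_of_pos hs, div_le_iff₀ hs, abs_pow]
    calc κ * |w t| ^ 2 * |Real.cos (κ * (t - a))| ≤ κ * |w t| ^ 2 * 1 := by gcongr
      _ = (κ * |w t|) * |w t| := by ring
      _ ≤ (M * Real.pi / 2 * Real.sin (κ * (t - a))) * |w t| := by gcongr
      _ = _ := by ring
  have hF0 : ∀ t ∈ Icc a b, w t = 0 → ContinuousWithinAt F (Icc a b) t := by
    intro t ht h0
    have hF : F t = 0 := by simp [F, h0]
    have hlim : Filter.Tendsto (fun s => M * Real.pi / 2 * |w s|) (nhdsWithin t (Icc a b))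
        (nhds 0) := by
      have := ((hw t ht).abs.const_mul (M * Real.pi / 2))
      simpa [ContinuousWithinAt, h0] using this
    unfold ContinuousWithinAt
    rw [hF]
    refine squeeze_zero_norm' ?_ hlim
    filter_upwards [self_mem_nhdsWithin] with s hs using hFb s hs
  have hFd : ∀ t ∈ Ioo a b, HasDerivAt F (2 * κ * w t * p t * Real.cos (κ * (t - a)) /
      Real.sin (κ * (t - a)) - κ ^ 2 * w t ^ 2 / Real.sin (κ * (t - a)) ^ 2) t := by
    intro t ht
    have hs := (hsin t ht).ne'
    have hθ : HasDerivAt (fun t => κ * (t - a)) κ t := by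
      simpa using ((hasDerivAt_id t).sub_const a).const_mul κ
    have := ((((hd t ht).pow 2).const_mul κ).mul hθ.cos).div hθ.sin hs
    refine this.congr_deriv ?_
    have := Real.sin_sq_add_cos_sq (κ * (t - a))
    simp only [Pi.mul_apply, Pi.pow_apply]
    field_simp
    push_cast
    linear_combination (-(κ * w t ^ 2)) * this
  have hFc : ContinuousOn F (Icc a b) := by
    intro t ht
    by_cases hta : t = a
    · exact hF0 t ht (hta ▸ hwa)
    by_cases htb : t = b
    · exact hF0 t ht (htb ▸ hwb)
    exact (hFd t ⟨lt_of_le_of_ne ht.1 (Ne.symm hta),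
      lt_of_le_of_ne ht.2 htb⟩).continuousAt.continuousWithinAt
  have hφ : ContinuousOn (fun t => p t * p t - κ ^ 2 * (w t * w t)) (Icc a b) :=
    (hp.mul hp).sub (continuousOn_const.mul (hw.mul hw))
  have main := intervalIntegral.sub_le_integral_of_hasDeriv_right_of_le h.le hFc
    (fun t ht => (hFd t ht).hasDerivWithinAt) hφ.integrableOn_Icc (by
      intro t ht
      have hs := (hsin t ht).ne'
      have hsc := Real.sin_sq_add_cos_sq (κ * (t - a))
      have : p t * p t - κ ^ 2 * (w t * w t) - (2 * κ * w t * p t * Real.cos (κ * (t - a)) /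
          Real.sin (κ * (t - a)) - κ ^ 2 * w t ^ 2 / Real.sin (κ * (t - a)) ^ 2) =
          (p t - κ * w t * Real.cos (κ * (t - a)) / Real.sin (κ * (t - a))) ^ 2 := by
        field_simp
        linear_combination (-(κ ^ 2 * w t ^ 2)) * hsc
      nlinarith [sq_nonneg (p t - κ * w t * Real.cos (κ * (t - a)) / Real.sin (κ * (t - a)))])
  have hFab : F b - F a = 0 := by simp [F, hwa, hwb]
  have i₁ : IntervalIntegrable (fun t => p t * p t) volume a b :=
    (hp.mul hp).intervalIntegrable_of_Icc h.le
  have i₂ : IntervalIntegrable (fun t => κ ^ 2 * (w t * w t)) volume a b :=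
    (continuousOn_const.mul (hw.mul hw)).intervalIntegrable_of_Icc h.le
  rw [hFab, intervalIntegral.integral_sub i₁ i₂,
    intervalIntegral.integral_const_mul] at main
  refine Real.le_sqrt_of_sq_le ?_
  rw [mul_pow, l2norm_sq h.le]
  unfold ip
  linarith

/-- The Poincaré inequality with the constant of Payne and Weinberger. -/
theorem IsPrimitive.poincare (hv : IsPrimitive a b v g) (h : a < b) (hg : IsL2 a b g) :
    l2norm a b (fun t => v t - (∫ r in a..b, v r) / (b - a)) ≤
      (b - a) / Real.pi * l2norm a b g := by
  set m := (∫ r in a..b, v r) / (b - a) with hm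
  have hba : 0 < b - a := sub_pos.2 h
  have hy := hv.sub_const m
  have hyc := hy.continuousOn h.le
  have hyi : IntervalIntegrable (fun t => v t - m) volume a b :=
    hyc.intervalIntegrable_of_Icc h.le
  -- The primitive of `v - m` vanishes at both ends because `v - m` has mean zero, so `wirtinger`
  -- applies to it.
  have hw := hyi.isPrimitive h.le (left_mem_Icc.2 h.le) 0
  have hwc := hw.continuousOn h.le
  have hint : ∫ r in a..b, (v r - m) = 0 := by
    rw [intervalIntegral.integral_sub ((hv.continuousOn h.le).intervalIntegrable_of_Icc h.le)
      (by simp), intervalIntegral.integral_const, smul_eq_mul, hm]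
    field_simp
    ring
  obtain ⟨M, hM⟩ := isCompact_Icc.exists_bound_of_continuousOn hyc
  have hsub : ∀ s ∈ Icc a b, ∀ t ∈ Icc a b, IntervalIntegrable (fun t => v t - m) volume s t :=
    fun s hs t ht => (hyc.mono (uIcc_subset_Icc hs ht)).intervalIntegrable
  have hbd : ∀ s ∈ Icc a b, ∀ t ∈ Icc a b, s ≤ t →
      |∫ r in s..t, (v r - m)| ≤ M * (t - s) := by
    intro s hs t ht hst
    have := intervalIntegral.norm_integral_le_of_norm_le_const (a := s) (b := t) (C := M)
      (f := fun r => v r - m) (fun r hr => by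
        rw [uIoc_of_le hst] at hr
        exact hM r ⟨hs.1.trans hr.1.le, hr.2.trans ht.2⟩)
    rwa [abs_of_nonneg (sub_nonneg.2 hst)] at this
  have hma := left_mem_Icc.2 h.le
  have hmb := right_mem_Icc.2 h.le
  have hwt := wirtinger (M := M) h hwc (fun t ht => by
      have hn := Icc_mem_nhds ht.1 ht.2
      refine (intervalIntegral.integral_hasDerivAt_right (hsub a hma t (Ioo_subset_Icc_self ht))
        ?_ (hyc.continuousAt hn)).const_add 0
      exact (hyc.mono Ioo_subset_Icc_self).stronglyMeasurableAtFilter isOpen_Ioo t ht) hyc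
    (fun t ht => by rw [zero_add]; exact hbd a hma t ht ht.1)
    (fun t ht => by
      have e := intervalIntegral.integral_add_adjacent_intervals (hsub a hma t ht)
        (hsub t ht b hmb)
      rw [hint] at e
      rw [zero_add, eq_neg_of_add_eq_zero_left e, abs_neg]
      exact hbd t ht b hmb ht.2)
  -- With `w` this primitive, `‖v - m‖² = -(w, g) ≤ ‖w‖ ‖g‖`, and `wirtinger` bounds `‖w‖` by `(b -
  -- a) / π * ‖v - m‖`; one factor `‖v - m‖` cancels.
  have hibp := hw.integral_mul_eq hy h.le
  rw [intervalIntegral.integral_same, hint] at hibp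
  have hcs := (neg_le_abs _).trans (abs_ip_le h.le hwc.isL2 hg)
  set y := l2norm a b (fun t => v t - m) with hydef
  set z := l2norm a b (fun t => 0 + ∫ s in a..t, (v s - m)) with hz
  have hysq : y ^ 2 ≤ z * l2norm a b g := by
    rw [hydef, l2norm_sq h.le]
    linarith
  have hz' : z ≤ (b - a) / Real.pi * y := by
    have hpi := Real.pi_pos
    calc z = (b - a) / Real.pi * (Real.pi / (b - a) * z) := by field_simp
      _ ≤ _ := by gcongr
  rcases (l2norm_nonneg a b (fun t => v t - m)).eq_or_lt with h0 | h0
  · rw [hydef, ← h0]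
    have := l2norm_nonneg a b g
    have := Real.pi_pos
    positivity
  · have hgn := l2norm_nonneg a b g
    refine le_of_mul_le_mul_right ?_ h0
    calc y * y = y ^ 2 := by ring
      _ ≤ z * l2norm a b g := hysq
      _ ≤ (b - a) / Real.pi * y * l2norm a b g := by gcongr
      _ = _ := by ring

/-- A Friedrichs inequality. -/
theorem IsPrimitive.friedrichs (hv : IsPrimitive a b v g) (h : a < b) (hg : IsL2 a b g)
    {e : ℝ} (he : e ∈ Icc a b) (h0 : v e = 0) : l2norm a b v ≤ (b - a) * l2norm a b g := by
  have hone : IsL2 a b (fun _ => 1) := continuousOn_const.isL2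
  have hl1 : l2norm a b (fun _ => 1) = Real.sqrt (b - a) := by simp [l2norm, ip]
  -- A pointwise bound from `v t = ∫ g` over `(e, t)` and Cauchy-Schwarz; its `L²` norm contributes
  -- a second factor `√(b - a)`. The resulting constant is not sharp, but a bound independent of the
  -- interval suffices.
  have hbound : ∀ t ∈ Icc a b, |v t| ≤ Real.sqrt (b - a) * l2norm a b g := by
    intro t ht
    have hs : uIoc e t ⊆ Ioc a b := by
      intro r hr
      exact ⟨(le_min he.1 ht.1).trans_lt hr.1, hr.2.trans (max_le he.2 ht.2)⟩
    have hvt : v t = ∫ r in e..t, g r := by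
      have i₁ : IntervalIntegrable g volume a e := hv.1.mono_set (by
        rw [uIcc_of_le h.le, uIcc_of_le he.1]; exact Icc_subset_Icc le_rfl he.2)
      have i₂ : IntervalIntegrable g volume e t :=
        hv.1.mono_set (by rw [uIcc_of_le h.le]; exact uIcc_subset_Icc he ht)
      have e₁ := hv.2 e he
      rw [hv.2 t ht, ← intervalIntegral.integral_add_adjacent_intervals i₁ i₂]
      linarith
    have hint := hv.1
    rw [intervalIntegrable_iff_integrableOn_Ioc_of_le h.le] at hint
    calc |v t| ≤ ∫ r in uIoc e t, ‖g r‖ := by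
          rw [hvt]
          exact intervalIntegral.norm_integral_le_integral_norm_uIoc (f := g) (μ := volume)
      _ ≤ ∫ r in Ioc a b, ‖g r‖ :=
          setIntegral_mono_set hint.norm (Filter.Eventually.of_forall fun r => norm_nonneg _)
            hs.eventuallyLE
      _ = ip a b (fun _ => 1) (fun r => |g r|) := by
          rw [ip_eq h.le, integral_Ioc_eq_integral_Ioo]; simp
      _ ≤ l2norm a b (fun _ => 1) * l2norm a b (fun r => |g r|) :=
          (le_abs_self _).trans (abs_ip_le h.le hone hg.abs)
      _ = _ := by rw [hl1, l2norm_abs]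
  have hK : 0 ≤ Real.sqrt (b - a) * l2norm a b g :=
    mul_nonneg (Real.sqrt_nonneg _) (l2norm_nonneg ..)
  calc l2norm a b v ≤ l2norm a b (fun _ => Real.sqrt (b - a) * l2norm a b g * 1) := by
        refine l2norm_le_of_abs_le h.le continuousOn_const.isL2 ?_
        filter_upwards [ae_restrict_mem measurableSet_Ioo] with t ht
        rw [mul_one, abs_of_nonneg hK]
        exact hbound t (Ioo_subset_Icc_self ht)
    _ = Real.sqrt (b - a) * l2norm a b g * Real.sqrt (b - a) := by
        rw [l2norm_const_mul a b _ (fun _ => 1), hl1, abs_of_nonneg hK]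
    _ = (Real.sqrt (b - a) * Real.sqrt (b - a)) * l2norm a b g := by ring
    _ = _ := by rw [Real.mul_self_sqrt (sub_pos.2 h).le]

/-- Shows that the best constants, defined as infima, are themselves admissible. The case `y = 0` is
where nonemptiness alone decides. -/
theorem le_sInf_mul {S : Set ℝ} (hS : S.Nonempty) {x y : ℝ} (hy : 0 ≤ y)
    (h : ∀ r ∈ S, x ≤ r * y) : x ≤ sInf S * y := by
  rcases hy.eq_or_lt with h0 | h0
  · obtain ⟨r, hr⟩ := hS
    simpa [← h0] using h r hr
  · rw [← div_le_iff₀ h0]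
    exact le_csInf hS fun r hr => (div_le_iff₀ h0).2 (h r hr)

/-- An admissible constant makes the infimum meaningful and bounds it uniformly over all intervals;
`1 / π ≤ 1` is all that is needed here. -/
theorem one_mem_poincareSet (h : a < b) : (1 : ℝ) ∈ {c : ℝ | 0 < c ∧ ∀ v g : ℝ → ℝ,
    IsH1 a b v g → l2norm a b (fun t => v t - (∫ r in a..b, v r) / (b - a)) ≤
      (b - a) * c * l2norm a b g} := by
  refine ⟨one_pos, fun v g hv => ((hv.isPrimitive h).poincare h hv.memLp_deriv).trans ?_⟩
  have := sub_pos.2 h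
  refine mul_le_mul_of_nonneg_right ?_ (l2norm_nonneg ..)
  rw [mul_one]
  exact div_le_self this.le (by linarith [Real.pi_gt_three])

theorem one_mem_friedrichsSet (h : a < b) {e : ℝ} (he : e ∈ Icc a b) :
    (1 : ℝ) ∈ {c : ℝ | 0 < c ∧ ∀ v g : ℝ → ℝ, IsH1 a b v g → v e = 0 →
      l2norm a b v ≤ (b - a) * c * l2norm a b g} :=
  ⟨one_pos, fun v g hv h0 => by
    rw [mul_one]; exact (hv.isPrimitive h).friedrichs h hv.memLp_deriv he h0⟩

theorem poincareConst_le_one (h : a < b) : poincareConst a b ≤ 1 :=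
  csInf_le ⟨0, fun _ hc => hc.1.le⟩ (one_mem_poincareSet h)

theorem friedrichsConst_le_one (h : a < b) {e : ℝ} (he : e ∈ Icc a b) :
    friedrichsConst a b e ≤ 1 :=
  csInf_le ⟨0, fun _ hc => hc.1.le⟩ (one_mem_friedrichsSet h he)

theorem poincareConst_nonneg (a b : ℝ) : 0 ≤ poincareConst a b :=
  Real.sInf_nonneg fun _ hc => hc.1.le

theorem friedrichsConst_nonneg (a b e : ℝ) : 0 ≤ friedrichsConst a b e :=
  Real.sInf_nonneg fun _ hc => hc.1.le

theorem IsH1.le_poincareConst (h : a < b) (hv : IsH1 a b v g) :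
    l2norm a b (fun t => v t - (∫ r in a..b, v r) / (b - a)) ≤
      poincareConst a b * ((b - a) * l2norm a b g) :=
  le_sInf_mul ⟨1, one_mem_poincareSet h⟩
    (mul_nonneg (sub_pos.2 h).le (l2norm_nonneg ..)) fun c hc => by
      linarith [hc.2 v g hv]

theorem IsH1.le_friedrichsConst (h : a < b) {e : ℝ} (he : e ∈ Icc a b) (hv : IsH1 a b v g)
    (h0 : v e = 0) : l2norm a b v ≤ friedrichsConst a b e * ((b - a) * l2norm a b g) :=
  le_sInf_mul ⟨1, one_mem_friedrichsSet h he⟩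
    (mul_nonneg (sub_pos.2 h).le (l2norm_nonneg ..)) fun c hc => by
      linarith [hc.2 v g hv h0]

/-! ### The duality argument on a patch -/

/-- If `β z' = R + β D E` with `∫ R = 0` and `|D| ≤ G`, then testing with a function `v` such that
`v' = z` and `v z` has no boundary contribution bounds `z` by `R` and `E`. -/
theorem l2norm_le_of_dual {z ζ R D E : ℝ → ℝ} {β C G : ℝ} (h : a < b) (hβ : β ≠ 0)
    (hz : IsPrimitive a b z ζ) (hv : IsPrimitive a b v z) (hbd : v b * z b - v a * z a = 0)
    (hζ : ∀ᵐ t ∂volume.restrict (Ioo a b), β * ζ t = R t + β * (D t * E t))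
    (hR : IsL2 a b R) (hR0 : ∫ t in a..b, R t = 0) (hE : IsL2 a b E)
    (hDm : AEStronglyMeasurable D (volume.restrict (Ioo a b)))
    (hD : ∀ᵐ t ∂volume.restrict (Ioo a b), |D t| ≤ G) (hG : 0 ≤ G) (hC : 0 ≤ C)
    (hvz : l2norm a b v ≤ C * l2norm a b z) :
    l2norm a b z ≤ C * G * l2norm a b E + (b - a) / (Real.pi * |β|) * l2norm a b R := by
  have hzc := hz.continuousOn h.le
  have hvc := hv.continuousOn h.le
  have hDE : IsL2 a b (fun t => D t * E t) := hE.bdd_mul hDm G hD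
  have hDEn : l2norm a b (fun t => D t * E t) ≤ G * l2norm a b E := by
    rw [← abs_of_nonneg hG, ← l2norm_const_mul]
    refine l2norm_le_of_abs_le h.le (hE.const_mul G) ?_
    filter_upwards [hD] with t ht
    rw [abs_mul, abs_mul, abs_of_nonneg hG]
    gcongr
  set m := (∫ r in a..b, v r) / (b - a) with hm
  have hvm : IsL2 a b (fun t => v t - m) := (hvc.sub continuousOn_const).isL2
  have hpoinc := hv.poincare h hzc.isL2
  rw [← hm] at hpoinc
  have e₁ : ip a b z z = - ip a b v ζ := by
    rw [hv.integral_mul_eq hz h.le, hbd, zero_sub]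
  have e₂ : β * ip a b v ζ = ip a b v R + β * ip a b v (fun t => D t * E t) := by
    simp only [ip_eq h.le]
    rw [← integral_const_mul, ← integral_const_mul,
      ← integral_add (hvc.isL2.integrable_mul hR) ((hvc.isL2.integrable_mul hDE).const_mul β)]
    refine integral_congr_ae ?_
    filter_upwards [hζ] with t ht
    linear_combination v t * ht
  -- Only the `R` term profits from removing the mean of `v`; the term with `D E` keeps `v` itself
  -- and the constant `C`.
  have e₃ : ip a b v R = ip a b (fun t => v t - m) R := by
    have : ∀ t, (v t - m) * R t = v t * R t - m * R t := fun t => by ring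
    simp only [ip, this]
    rw [intervalIntegral.integral_sub (hvc.isL2.intervalIntegrable_mul h.le hR)
      ((hR.intervalIntegrable h.le).const_mul m), intervalIntegral.integral_const_mul, hR0]
    ring
  have b₁ := abs_ip_le h.le hvm hR
  have b₂ := abs_ip_le h.le hvc.isL2 hDE
  have hz0 := l2norm_nonneg a b z
  have hR' := l2norm_nonneg a b R
  have hE' := l2norm_nonneg a b E
  have hpi := Real.pi_pos
  have hβ' : 0 < |β| := abs_pos.2 hβ
  have b₃ : |β| * l2norm a b z ^ 2 ≤
      (b - a) / Real.pi * l2norm a b z * l2norm a b R +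
        |β| * ((C * l2norm a b z) * (G * l2norm a b E)) := by
    calc |β| * l2norm a b z ^ 2 = |β * ip a b v ζ| := by
          rw [l2norm_sq h.le, abs_mul, ← abs_neg (ip a b v ζ), ← e₁,
            abs_of_nonneg (ip_self_nonneg h.le z)]
      _ ≤ |ip a b (fun t => v t - m) R| + |β| * |ip a b v (fun t => D t * E t)| := by
          rw [e₂, e₃, ← abs_mul]; exact abs_add_le _ _
      _ ≤ l2norm a b (fun t => v t - m) * l2norm a b R +
          |β| * (l2norm a b v * l2norm a b (fun t => D t * E t)) := by gcongr
      _ ≤ _ := by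
          have := (l2norm_nonneg a b v).trans hvz
          have := l2norm_nonneg a b fun t => D t * E t
          gcongr
  rcases hz0.eq_or_lt with h0 | h0
  · rw [← h0]
    have := sub_pos.2 h
    positivity
  · refine le_of_mul_le_mul_left ?_ (mul_pos hβ' h0)
    calc |β| * l2norm a b z * l2norm a b z = |β| * l2norm a b z ^ 2 := by ring
      _ ≤ _ := b₃
      _ = _ := by field_simp; ring

/-! ### Polynomials on an interval -/

/-- `v` is a polynomial of degree at most `d` on `(a, b)`. -/
def PolyOn (d : ℕ) (a b : ℝ) (v : ℝ → ℝ) : Prop :=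
  ∃ p : Polynomial ℝ, p.natDegree ≤ d ∧ ∀ t ∈ Ioo a b, v t = p.eval t

namespace PolyOn

variable {d e : ℕ}

theorem mono (hv : PolyOn d a b v) (h : d ≤ e) : PolyOn e a b v := by
  obtain ⟨p, hp, hpe⟩ := hv
  exact ⟨p, hp.trans h, hpe⟩

theorem sub (hv : PolyOn d a b v) (hw : PolyOn d a b w) :
    PolyOn d a b (fun t => v t - w t) := by
  obtain ⟨p, hp, hpe⟩ := hv
  obtain ⟨q, hq, hqe⟩ := hw
  exact ⟨p - q, (Polynomial.natDegree_sub_le _ _).trans (max_le hp hq), fun t ht => by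
    simp [hpe t ht, hqe t ht]⟩

theorem mul (hv : PolyOn d a b v) (hw : PolyOn e a b w) :
    PolyOn (d + e) a b (fun t => v t * w t) := by
  obtain ⟨p, hp, hpe⟩ := hv
  obtain ⟨q, hq, hqe⟩ := hw
  exact ⟨p * q, Polynomial.natDegree_mul_le.trans (add_le_add hp hq), fun t ht => by
    simp [hpe t ht, hqe t ht]⟩

theorem const (r : ℝ) : PolyOn d a b (fun _ => r) :=
  ⟨Polynomial.C r, by simp, fun t _ => by simp⟩

theorem const_mul (hv : PolyOn d a b v) (r : ℝ) : PolyOn d a b (fun t => r * v t) := by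
  obtain ⟨p, hp, hpe⟩ := hv
  exact ⟨Polynomial.C r * p, (Polynomial.natDegree_C_mul_le _ _).trans hp, fun t ht => by
    simp [hpe t ht]⟩

theorem deriv (hv : PolyOn (d + 1) a b v) : PolyOn d a b (deriv v) := by
  obtain ⟨p, hp, hpe⟩ := hv
  refine ⟨p.derivative, (Polynomial.natDegree_derivative_le p).trans (by omega), fun t ht => ?_⟩
  rw [← p.deriv]
  refine Filter.EventuallyEq.deriv_eq ?_
  filter_upwards [Ioo_mem_nhds ht.1 ht.2] with s hs using hpe s hs

theorem isL2 (hv : PolyOn d a b v) : IsL2 a b v := by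
  obtain ⟨p, hp, hpe⟩ := hv
  refine (p.continuous.continuousOn.isL2 (a := a) (b := b)).congr ?_
  filter_upwards [ae_restrict_mem measurableSet_Ioo] with t ht using (hpe t ht).symm

/-- A continuous function that is a polynomial inside an interval is a primitive of its
derivative. -/
theorem isPrimitive (hv : PolyOn d a b v) (h : a ≤ b) (hc : ContinuousOn v (Icc a b)) :
    IsPrimitive a b v (_root_.deriv v) := by
  -- A degenerate interval occurs at a boundary vertex, where one half of the patch is a single
  -- point.
  rcases h.eq_or_lt with rfl | h'
  · refine ⟨by simp, fun t ht => ?_⟩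
    rw [Icc_self, mem_singleton_iff] at ht
    simp [ht]
  · obtain ⟨p, hp, hpe⟩ := hv
    have heq : ∀ t ∈ Icc a b, v t = p.eval t := by
      have : EqOn v (fun t => p.eval t) (Ioo a b) := hpe
      exact this.of_subset_closure hc p.continuous.continuousOn Ioo_subset_Icc_self
        (closure_Ioo h'.ne).ge
    refine ((IsPrimitive.polynomial p a b).congr_left h heq).congr_right h ?_
    filter_upwards [ae_restrict_mem measurableSet_Ioo] with t ht
    rw [← p.deriv]
    refine Filter.EventuallyEq.deriv_eq ?_
    filter_upwards [Ioo_mem_nhds ht.1 ht.2] with s hs using (hpe s hs).symm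

end PolyOn

/-! ### Geometry of patches and hat functions -/

namespace Mesh

variable (T : Mesh)

theorem pl_le (a : Fin (T.n + 1)) : T.pl a ≤ T.x a := T.strictMono.monotone (by simp [Fin.le_def])

theorem le_pr (a : Fin (T.n + 1)) : T.x a ≤ T.pr a := T.strictMono.monotone (by
  have := a.2
  simp only [Fin.le_def]; omega)

theorem pl_lt_pr (a : Fin (T.n + 1)) : T.pl a < T.pr a := T.strictMono (by
  have := a.2
  have := T.n_pos
  simp only [Fin.lt_def]; omega)

theorem lo_le_pl (a : Fin (T.n + 1)) : T.lo ≤ T.pl a := T.strictMono.monotone (Fin.zero_le _)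

theorem pr_le_hi (a : Fin (T.n + 1)) : T.pr a ≤ T.hi := T.strictMono.monotone (Fin.le_last _)

theorem lo_lt_hi : T.lo < T.hi :=
  (T.lo_le_pl 0).trans_lt ((T.pl_lt_pr 0).trans_le (T.pr_le_hi 0))

theorem pl_eq_iff (a : Fin (T.n + 1)) : T.pl a = T.x a ↔ a = 0 := by
  unfold pl
  rw [T.strictMono.injective.eq_iff, Fin.ext_iff, Fin.ext_iff, Fin.val_zero]
  simp only
  omega

theorem pr_eq_iff (a : Fin (T.n + 1)) : T.pr a = T.x a ↔ a = Fin.last T.n := by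
  have := a.2
  unfold pr
  rw [T.strictMono.injective.eq_iff, Fin.ext_iff, Fin.ext_iff]
  simp
  omega

theorem pl_succ (i : Fin T.n) : T.pl i.succ = T.x i.castSucc := by
  unfold pl; congr 1

theorem pr_castSucc (i : Fin T.n) : T.pr i.castSucc = T.x i.succ := by
  unfold pr; congr 1; ext; simp

/-- At a boundary vertex one of the two intervals is empty and its condition is vacuous, so interior
and boundary vertices can be treated alike. -/
theorem isPatchPoly_iff {d : ℕ} {a : Fin (T.n + 1)} {v : ℝ → ℝ} :
    T.IsPatchPoly d a v ↔ PolyOn d (T.pl a) (T.x a) v ∧ PolyOn d (T.x a) (T.pr a) v := by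
  constructor
  · refine fun hv => ⟨?_, ?_⟩
    · by_cases h0 : a = 0
      · rw [(T.pl_eq_iff a).2 h0]
        exact ⟨0, by simp, fun t ht => absurd (ht.1.trans ht.2) (lt_irrefl _)⟩
      · obtain ⟨i, rfl⟩ := Fin.exists_succ_eq.2 h0
        rw [pl_succ]
        exact hv i (by simp [elemVertices])
    · by_cases h0 : a = Fin.last T.n
      · rw [(T.pr_eq_iff a).2 h0]
        exact ⟨0, by simp, fun t ht => absurd (ht.1.trans ht.2) (lt_irrefl _)⟩
      · obtain ⟨i, rfl⟩ := Fin.exists_castSucc_eq.2 h0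
        rw [pr_castSucc]
        exact hv i (by simp [elemVertices])
  · rintro ⟨h₁, h₂⟩ i hi
    simp only [elemVertices, Finset.mem_insert, Finset.mem_singleton] at hi
    rcases hi with rfl | rfl
    · rwa [pr_castSucc] at h₂
    · rwa [pl_succ] at h₁

theorem IsPatchPoly.isL2 {T : Mesh} {d : ℕ} {a : Fin (T.n + 1)} {v : ℝ → ℝ}
    (hv : T.IsPatchPoly d a v) : IsL2 (T.pl a) (T.pr a) v := by
  rw [isPatchPoly_iff] at hv
  exact hv.1.isL2.trans (T.pl_le a) (T.le_pr a) hv.2.isL2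

theorem hat_left (a : Fin (T.n + 1)) (h : T.pl a < T.x a) {t : ℝ}
    (ht : t ∈ Icc (T.pl a) (T.x a)) : T.hat a t = (t - T.pl a) / (T.x a - T.pl a) := by
  have h0 : T.x a - T.pl a ≠ 0 := (sub_pos.2 h).ne'
  unfold hat
  split_ifs with h₁ h₂ h₃
  · rw [h₁, div_self h0]
  · rfl
  · exact absurd h₃.1 (not_lt.2 ht.2)
  · have : t = T.pl a := by
      by_contra hne
      exact h₂ ⟨lt_of_le_of_ne ht.1 (Ne.symm hne), lt_of_le_of_ne ht.2 h₁⟩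
    simp [this]

theorem hat_right (a : Fin (T.n + 1)) (h : T.x a < T.pr a) {t : ℝ}
    (ht : t ∈ Icc (T.x a) (T.pr a)) : T.hat a t = (T.pr a - t) / (T.pr a - T.x a) := by
  have h0 : T.pr a - T.x a ≠ 0 := (sub_pos.2 h).ne'
  unfold hat
  split_ifs with h₁ h₂ h₃
  · rw [h₁, div_self h0]
  · exact absurd h₂.2 (not_lt.2 ht.1)
  · rfl
  · have : t = T.pr a := by
      by_contra hne
      exact h₃ ⟨lt_of_le_of_ne ht.1 (Ne.symm h₁), lt_of_le_of_ne ht.2 hne⟩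
    simp [this]

theorem hat_of_lt (a : Fin (T.n + 1)) {t : ℝ} (h : t < T.pl a) : T.hat a t = 0 := by
  have := T.pl_le a
  rw [hat, if_neg (by linarith), if_neg fun h' => by linarith [h'.1],
    if_neg fun h' => by linarith [h'.1]]

theorem hat_of_gt (a : Fin (T.n + 1)) {t : ℝ} (h : T.pr a < t) : T.hat a t = 0 := by
  have := T.le_pr a
  rw [hat, if_neg (by linarith), if_neg fun h' => by linarith [h'.2],
    if_neg fun h' => by linarith [h'.2]]

/-- The first vertex is exceptional because the left end of its patch is the vertex itself, where
the hat function equals one. -/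
theorem hat_pl (a : Fin (T.n + 1)) : T.hat a (T.pl a) = 0 ∨ a = 0 := by
  by_cases h : a = 0
  · exact Or.inr h
  · have h' := lt_of_le_of_ne (T.pl_le a) (mt (T.pl_eq_iff a).1 h)
    left
    rw [T.hat_left a h' (left_mem_Icc.2 h'.le), sub_self, zero_div]

theorem hat_pr (a : Fin (T.n + 1)) : T.hat a (T.pr a) = 0 ∨ a = Fin.last T.n := by
  by_cases h : a = Fin.last T.n
  · exact Or.inr h
  · have h' := lt_of_le_of_ne (T.le_pr a) (Ne.symm (mt (T.pr_eq_iff a).1 h))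
    left
    rw [T.hat_right a h' (right_mem_Icc.2 h'.le), sub_self, zero_div]

theorem abs_hat_le_one (a : Fin (T.n + 1)) (t : ℝ) : |T.hat a t| ≤ 1 := by
  unfold hat
  split_ifs with h₁ h₂ h₃
  · simp
  · rw [abs_of_nonneg (div_nonneg (by linarith [h₂.1]) (by linarith [T.pl_le a]))]
    exact div_le_one_of_le₀ (by linarith [h₂.2]) (by linarith [T.pl_le a])
  · rw [abs_of_nonneg (div_nonneg (by linarith [h₃.2]) (by linarith [T.le_pr a]))]
    exact div_le_one_of_le₀ (by linarith [h₃.1]) (by linarith [T.le_pr a])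
  · simp

theorem continuousOn_hat_left (a : Fin (T.n + 1)) :
    ContinuousOn (T.hat a) (Icc (T.pl a) (T.x a)) := by
  rcases (T.pl_le a).eq_or_lt with h | h
  · rw [h, Icc_self]; exact continuousOn_singleton _ _
  · exact ContinuousOn.congr (by fun_prop) fun t ht => T.hat_left a h ht

theorem continuousOn_hat_right (a : Fin (T.n + 1)) :
    ContinuousOn (T.hat a) (Icc (T.x a) (T.pr a)) := by
  rcases (T.le_pr a).eq_or_lt with h | h
  · rw [h, Icc_self]; exact continuousOn_singleton _ _
  · exact ContinuousOn.congr (by fun_prop) fun t ht => T.hat_right a h ht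

theorem polyOn_hat_left (a : Fin (T.n + 1)) : PolyOn 1 (T.pl a) (T.x a) (T.hat a) := by
  refine ⟨Polynomial.C (T.x a - T.pl a)⁻¹ * (Polynomial.X - Polynomial.C (T.pl a)),
    (Polynomial.natDegree_C_mul_le _ _).trans (Polynomial.natDegree_X_sub_C_le _), fun t ht => ?_⟩
  rw [T.hat_left a (ht.1.trans ht.2) (Ioo_subset_Icc_self ht)]
  simp [div_eq_inv_mul]

theorem polyOn_hat_right (a : Fin (T.n + 1)) : PolyOn 1 (T.x a) (T.pr a) (T.hat a) := by
  refine ⟨Polynomial.C (-(T.pr a - T.x a)⁻¹) * (Polynomial.X - Polynomial.C (T.pr a)),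
    (Polynomial.natDegree_C_mul_le _ _).trans (Polynomial.natDegree_X_sub_C_le _), fun t ht => ?_⟩
  rw [T.hat_right a (ht.1.trans ht.2) (Ioo_subset_Icc_self ht)]
  simp [div_eq_inv_mul]
  ring

theorem isPatchPoly_hat (a : Fin (T.n + 1)) : T.IsPatchPoly 1 a (T.hat a) :=
  T.isPatchPoly_iff.2 ⟨T.polyOn_hat_left a, T.polyOn_hat_right a⟩

theorem isPatchPoly_deriv_hat (a : Fin (T.n + 1)) : T.IsPatchPoly 0 a (deriv (T.hat a)) :=
  T.isPatchPoly_iff.2 ⟨(T.polyOn_hat_left a).deriv, (T.polyOn_hat_right a).deriv⟩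

/-- The product of the hat function and a continuous piecewise polynomial is a primitive of its
derivative. -/
theorem isPrimitive_hat_mul {d : ℕ} {a : Fin (T.n + 1)} {s : ℝ → ℝ} (hs : T.IsPatchPoly d a s)
    (hc : ContinuousOn s (Icc (T.pl a) (T.pr a))) :
    IsPrimitive (T.pl a) (T.pr a) (fun t => T.hat a t * s t)
      (deriv fun t => T.hat a t * s t) := by
  rw [isPatchPoly_iff] at hs
  have h₁ := T.pl_le a
  have h₂ := T.le_pr a
  exact (((T.polyOn_hat_left a).mul hs.1).isPrimitive h₁ ((T.continuousOn_hat_left a).mul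
    (hc.mono (Icc_subset_Icc le_rfl h₂)))).trans
    (((T.polyOn_hat_right a).mul hs.2).isPrimitive h₂ ((T.continuousOn_hat_right a).mul
    (hc.mono (Icc_subset_Icc h₁ le_rfl)))) h₁

theorem isPrimitive_hat (a : Fin (T.n + 1)) :
    IsPrimitive (T.pl a) (T.pr a) (T.hat a) (deriv (T.hat a)) :=
  ((T.polyOn_hat_left a).isPrimitive (T.pl_le a) (T.continuousOn_hat_left a)).trans
    ((T.polyOn_hat_right a).isPrimitive (T.le_pr a) (T.continuousOn_hat_right a)) (T.pl_le a)

/-- The hat function raises the degree by one and the derivative lowers it again, so `(ψ_a s)'` lies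
in the test space. -/
theorem isPatchPoly_deriv_hat_mul {d : ℕ} {a : Fin (T.n + 1)} {s : ℝ → ℝ}
    (hs : T.IsPatchPoly d a s) : T.IsPatchPoly d a (deriv fun t => T.hat a t * s t) := by
  rw [isPatchPoly_iff] at hs ⊢
  exact ⟨(((T.polyOn_hat_left a).mul hs.1).mono (by omega)).deriv,
    (((T.polyOn_hat_right a).mul hs.2).mono (by omega)).deriv⟩

/-- An empty half of the patch contributes `0⁻¹ = 0` to the maximum. Points outside the patch are
included since `hatGradSup` is taken over all of `Ω`. -/
theorem abs_deriv_hat_le (a : Fin (T.n + 1)) {t : ℝ} (h₁ : t ≠ T.pl a) (h₂ : t ≠ T.x a)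
    (h₃ : t ≠ T.pr a) :
    |deriv (T.hat a) t| ≤ max (T.x a - T.pl a)⁻¹ (T.pr a - T.x a)⁻¹ := by
  have hl : 0 ≤ (T.x a - T.pl a)⁻¹ := inv_nonneg.2 (sub_nonneg.2 (T.pl_le a))
  have hr : 0 ≤ (T.pr a - T.x a)⁻¹ := inv_nonneg.2 (sub_nonneg.2 (T.le_pr a))
  rcases lt_or_gt_of_ne h₁ with h | h
  · have : T.hat a =ᶠ[nhds t] fun _ => 0 := by
      filter_upwards [Iio_mem_nhds h] with s hs using T.hat_of_lt a hs
    rw [this.deriv_eq]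
    simpa using Or.inl (T.pl_le a)
  rcases lt_or_gt_of_ne h₃ with h' | h'
  · rcases lt_or_gt_of_ne h₂ with h'' | h''
    · have : T.hat a =ᶠ[nhds t] fun s => (s - T.pl a) / (T.x a - T.pl a) := by
        filter_upwards [Ioo_mem_nhds h h''] with s hs using
          T.hat_left a (h.trans h'') (Ioo_subset_Icc_self hs)
      have hd : HasDerivAt (fun s => (s - T.pl a) / (T.x a - T.pl a))
          (1 / (T.x a - T.pl a)) t := ((hasDerivAt_id t).sub_const _).div_const _
      rw [this.deriv_eq, hd.deriv, one_div, abs_of_nonneg hl]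
      exact le_max_left _ _
    · have : T.hat a =ᶠ[nhds t] fun s => (T.pr a - s) / (T.pr a - T.x a) := by
        filter_upwards [Ioo_mem_nhds h'' h'] with s hs using
          T.hat_right a (h''.trans h') (Ioo_subset_Icc_self hs)
      have hd : HasDerivAt (fun s => (T.pr a - s) / (T.pr a - T.x a))
          (-1 / (T.pr a - T.x a)) t := ((hasDerivAt_id t).const_sub _).div_const _
      rw [this.deriv_eq, hd.deriv, neg_div, one_div, abs_neg, abs_of_nonneg hr]
      exact le_max_right _ _
  · have : T.hat a =ᶠ[nhds t] fun _ => 0 := by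
      filter_upwards [Ioi_mem_nhds h'] with s hs using T.hat_of_gt a hs
    rw [this.deriv_eq]
    simpa using Or.inl (T.pl_le a)

theorem eLpNorm_deriv_hat_le (a : Fin (T.n + 1)) :
    eLpNorm (deriv (T.hat a)) ⊤ (volume.restrict (Ioo T.lo T.hi)) ≤
      ENNReal.ofReal (max (T.x a - T.pl a)⁻¹ (T.pr a - T.x a)⁻¹) := by
  rw [eLpNorm_exponent_top]
  refine eLpNormEssSup_le_of_ae_bound (ae_restrict_of_ae ?_)
  filter_upwards [Measure.ae_ne volume (T.pl a), Measure.ae_ne volume (T.x a),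
    Measure.ae_ne volume (T.pr a)] with t h₁ h₂ h₃ using T.abs_deriv_hat_le a h₁ h₂ h₃

theorem hatGradSup_le (a : Fin (T.n + 1)) :
    T.hatGradSup a ≤ max (T.x a - T.pl a)⁻¹ (T.pr a - T.x a)⁻¹ :=
  ENNReal.toReal_le_of_le_ofReal
    ((inv_nonneg.2 (sub_nonneg.2 (T.pl_le a))).trans (le_max_left _ _)) (T.eLpNorm_deriv_hat_le a)

theorem hatGradSup_nonneg (a : Fin (T.n + 1)) : 0 ≤ T.hatGradSup a := ENNReal.toReal_nonneg

/-- The essential supremum is finite, so `toReal` in `hatGradSup` loses nothing. -/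
theorem ae_abs_deriv_hat_le (a : Fin (T.n + 1)) :
    ∀ᵐ t ∂volume.restrict (Ioo (T.pl a) (T.pr a)), |deriv (T.hat a) t| ≤ T.hatGradSup a := by
  refine ae_mono (Measure.restrict_mono (Ioo_subset_Ioo (T.lo_le_pl a) (T.pr_le_hi a)) le_rfl) ?_
  filter_upwards [ae_le_eLpNormEssSup (f := deriv (T.hat a))
    (μ := volume.restrict (Ioo T.lo T.hi))] with t ht
  have hfin := ne_top_of_le_ne_top ENNReal.ofReal_ne_top (T.eLpNorm_deriv_hat_le a)
  rw [← eLpNorm_exponent_top] at ht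
  simpa only [toReal_enorm, Real.norm_eq_abs, hatGradSup] using ENNReal.toReal_mono hfin ht

theorem patchDiam_pos (a : Fin (T.n + 1)) : 0 < T.patchDiam a := sub_pos.2 (T.pl_lt_pr a)

/-- If the halves of the patch have lengths `x, y > 0`, then `(x + y) / x = 1 + y / x ≤ 1 + |κ|`,
and symmetrically. The absolute value matters: on a one-element mesh `ShapeRegular κ` holds
vacuously, even for negative `κ`. -/
theorem patchDiam_mul_hatGradSup_le {κ : ℝ} (hκ : T.ShapeRegular κ) (a : Fin (T.n + 1)) :
    T.patchDiam a * T.hatGradSup a ≤ 1 + |κ| := by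
  have hl := sub_nonneg.2 (T.pl_le a)
  have hr := sub_nonneg.2 (T.le_pr a)
  have key : ∀ x y : ℝ, 0 ≤ x → 0 ≤ y → (x ≠ 0 → y ≤ |κ| * x) → (x + y) * x⁻¹ ≤ 1 + |κ| := by
    intro x y hx hy hxy
    rcases hx.eq_or_lt with h | h
    · rw [← h]; simp; positivity
    · rw [← div_eq_mul_inv, div_le_iff₀ h]
      linarith [hxy h.ne']
  have hcomp : T.pr a - T.x a ≤ |κ| * (T.x a - T.pl a) ∨ T.x a = T.pl a := by
    by_cases h0 : a = 0
    · exact Or.inr ((T.pl_eq_iff a).2 h0).symm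
    left
    by_cases h1 : a = Fin.last T.n
    · rw [(T.pr_eq_iff a).2 h1, sub_self]; positivity
    obtain ⟨i, hi⟩ := Fin.exists_succ_eq.2 h0
    obtain ⟨j, hj⟩ := Fin.exists_castSucc_eq.2 h1
    have := (hκ i j (hi.trans hj.symm)).2
    have e₁ : T.elemDiam i = T.x a - T.pl a := by rw [← hi, pl_succ]; rfl
    have e₂ : T.elemDiam j = T.pr a - T.x a := by rw [← hj, pr_castSucc]; rfl
    rw [e₁, e₂] at this
    exact this.trans (by gcongr; exact le_abs_self κ)
  have hcomp' : T.x a - T.pl a ≤ |κ| * (T.pr a - T.x a) ∨ T.pr a = T.x a := by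
    by_cases h1 : a = Fin.last T.n
    · exact Or.inr ((T.pr_eq_iff a).2 h1)
    left
    by_cases h0 : a = 0
    · rw [(T.pl_eq_iff a).2 h0, sub_self]; positivity
    obtain ⟨i, hi⟩ := Fin.exists_succ_eq.2 h0
    obtain ⟨j, hj⟩ := Fin.exists_castSucc_eq.2 h1
    have := (hκ i j (hi.trans hj.symm)).1
    have e₁ : T.elemDiam i = T.x a - T.pl a := by rw [← hi, pl_succ]; rfl
    have e₂ : T.elemDiam j = T.pr a - T.x a := by rw [← hj, pr_castSucc]; rfl
    rw [e₁, e₂] at this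
    exact this.trans (by gcongr; exact le_abs_self κ)
  have e : T.patchDiam a = (T.x a - T.pl a) + (T.pr a - T.x a) := by unfold patchDiam; ring
  refine (mul_le_mul_of_nonneg_left (T.hatGradSup_le a) (T.patchDiam_pos a).le).trans ?_
  rw [mul_max_of_nonneg _ _ (T.patchDiam_pos a).le]
  refine max_le ?_ ?_
  · rw [e]
    exact key _ _ hl hr fun hne => hcomp.resolve_right fun h => hne (sub_eq_zero.2 h)
  · rw [e, add_comm]
    exact key _ _ hr hl fun hne => hcomp'.resolve_right fun h => hne (sub_eq_zero.2 h)

theorem cPF_nonneg (β : ℝ) (a : Fin (T.n + 1)) : 0 ≤ T.cPF β a := by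
  unfold cPF
  split_ifs
  · exact friedrichsConst_nonneg ..
  · exact poincareConst_nonneg ..

theorem cPF_le_one (β : ℝ) (a : Fin (T.n + 1)) : T.cPF β a ≤ 1 := by
  unfold cPF
  split_ifs
  · exact friedrichsConst_le_one (T.pl_lt_pr a) ⟨T.pl_le a, T.le_pr a⟩
  · exact poincareConst_le_one (T.pl_lt_pr a)

theorem contPF_le {κ : ℝ} (hκ : T.ShapeRegular κ) (β : ℝ) : T.contPF β ≤ 2 + |κ| := by
  refine Finset.sup'_le _ _ fun a _ => ?_
  have h₁ := T.patchDiam_mul_hatGradSup_le hκ a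
  have h₂ := mul_nonneg (T.patchDiam_pos a).le (T.hatGradSup_nonneg a)
  have h₃ := mul_le_of_le_one_left h₂ (T.cPF_le_one β a)
  rw [mul_assoc]
  linarith

theorem le_contPF (β : ℝ) (a : Fin (T.n + 1)) :
    1 + T.cPF β a * T.patchDiam a * T.hatGradSup a ≤ T.contPF β :=
  Finset.le_sup' (fun a : Fin (T.n + 1) => 1 + T.cPF β a * T.patchDiam a * T.hatGradSup a)
    (Finset.mem_univ a)

/-- On an element, only the hat functions of its two vertices contribute, and they add up to 1. -/
theorem sum_hat_mul {i : Fin T.n} {t : ℝ} (ht : t ∈ Ioo (T.x i.castSucc) (T.x i.succ))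
    (y : Fin (T.n + 1) → ℝ) :
    ∑ a, T.hat a t * y a = T.hat i.castSucc t * y i.castSucc + T.hat i.succ t * y i.succ := by
  have hne : i.castSucc ≠ i.succ := i.castSucc_lt_succ.ne
  rw [← Finset.sum_pair hne (f := fun a => T.hat a t * y a)]
  refine (Finset.sum_subset (Finset.subset_univ _) fun a _ ha => ?_).symm
  simp only [Finset.mem_insert, Finset.mem_singleton, not_or] at ha
  rw [mul_eq_zero]
  left
  rcases lt_or_gt_of_ne ha.1 with h | h
  · refine T.hat_of_gt a (lt_of_le_of_lt (T.strictMono.monotone ?_) ht.1)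
    simp only [Fin.lt_def, Fin.le_def, Fin.val_castSucc] at h ⊢
    omega
  · refine T.hat_of_lt a (lt_of_lt_of_le ht.2 (T.strictMono.monotone ?_))
    have := ha.2
    simp only [Fin.lt_def, Fin.le_def, Fin.ext_iff, Fin.val_castSucc, Fin.val_succ] at h this ⊢
    omega

theorem hat_add_hat {i : Fin T.n} {t : ℝ} (ht : t ∈ Ioo (T.x i.castSucc) (T.x i.succ)) :
    T.hat i.castSucc t + T.hat i.succ t = 1 := by
  have h := T.strictMono i.castSucc_lt_succ
  have h0 := (sub_pos.2 h).ne'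
  rw [T.hat_right i.castSucc (by rwa [pr_castSucc])
      (by rw [pr_castSucc]; exact Ioo_subset_Icc_self ht),
    T.hat_left i.succ (by rwa [pl_succ]) (by rw [pl_succ]; exact Ioo_subset_Icc_self ht),
    pr_castSucc, pl_succ]
  field_simp
  ring

/-! ### The continuous representative of the ultra-weak solution -/

/-- The ultra-weak solution is almost everywhere equal to the primitive of `f / β` that vanishes
at the inflow vertex. -/
theorem IsUltraWeakSolution.exists_primitive {T : Mesh} {β : ℝ} {f u : ℝ → ℝ} (hβ : β ≠ 0)
    (hf : IsL2 T.lo T.hi f) (hu : T.IsUltraWeakSolution β f u) :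
    ∃ U : ℝ → ℝ, IsPrimitive T.lo T.hi U (fun t => β⁻¹ * f t) ∧
      (T.outflow β = Fin.last T.n → U T.lo = 0) ∧ (T.outflow β = 0 → U T.hi = 0) ∧
      ∀ᵐ t ∂volume.restrict (Ioo T.lo T.hi), u t = U t := by
  have h := T.lo_lt_hi
  have hn : (0 : Fin (T.n + 1)) ≠ Fin.last T.n := by
    have := T.n_pos
    rw [Ne, Fin.ext_iff, Fin.val_zero, Fin.val_last]
    omega
  obtain ⟨y, z, hy, hz, hyz⟩ : ∃ y z : ℝ, y ∈ Icc T.lo T.hi ∧ z = T.x (T.outflow β) ∧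
      ((y = T.lo ∧ z = T.hi ∧ T.outflow β = Fin.last T.n) ∨
        (y = T.hi ∧ z = T.lo ∧ T.outflow β = 0)) := by
    by_cases hb : 0 < β
    · have : T.outflow β = Fin.last T.n := if_pos hb
      exact ⟨T.lo, T.hi, left_mem_Icc.2 h.le, by rw [this]; rfl, Or.inl ⟨rfl, rfl, this⟩⟩
    · have : T.outflow β = 0 := if_neg hb
      exact ⟨T.hi, T.lo, right_mem_Icc.2 h.le, by rw [this]; rfl, Or.inr ⟨rfl, rfl, this⟩⟩
  have hfi := (hf.const_mul β⁻¹).intervalIntegrable h.le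
  -- Here `y` is the inflow end and `z` the outflow end.
  set U : ℝ → ℝ := fun t => 0 + ∫ s in y..t, β⁻¹ * f s with hU
  have hUp : IsPrimitive T.lo T.hi U (fun t => β⁻¹ * f t) := hfi.isPrimitive h.le hy 0
  have hUy : U y = 0 := by simp [hU]
  have hUL := (hUp.continuousOn h.le).isL2
  have hg := hu.1.sub hUL
  have hzI : z ∈ Icc T.lo T.hi := by
    rcases hyz with ⟨-, rfl, -⟩ | ⟨-, rfl, -⟩
    exacts [right_mem_Icc.2 h.le, left_mem_Icc.2 h.le]
  have hv := (hg.intervalIntegrable h.le).isPrimitive h.le hzI 0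
  -- This `v` is an admissible test function with derivative `u - U`. The weak form and integration
  -- by parts for `U` then give the same value to `(u, u - U)` and `(U, u - U)`, so `‖u - U‖ = 0`.
  set v : ℝ → ℝ := fun t => 0 + ∫ s in z..t, (u s - U s) with hvdef
  have hvz : v z = 0 := by simp [hvdef]
  have hweak := hu.2 v _ (hv.isH1 h.le hg) (hz ▸ hvz)
  have hibp := hUp.integral_mul_eq hv h.le
  -- At the inflow end `U` vanishes, at the outflow end `v` does.
  have hbd : U T.hi * v T.hi - U T.lo * v T.lo = 0 := by
    rcases hyz with ⟨rfl, rfl, -⟩ | ⟨rfl, rfl, -⟩ <;> simp [hUy, hvz]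
  have e₁ : ip T.lo T.hi (fun t => β⁻¹ * f t) v = β⁻¹ * ip T.lo T.hi f v := by
    simp only [ip, mul_assoc, intervalIntegral.integral_const_mul]
  have e₂ : ip T.lo T.hi u (fun t => β * (u t - U t)) =
      β * ip T.lo T.hi u (fun t => u t - U t) := by
    simp only [ip, mul_left_comm _ β, intervalIntegral.integral_const_mul]
  have e₃ : ip T.lo T.hi (fun t => u t - U t) (fun t => u t - U t) =
      ip T.lo T.hi u (fun t => u t - U t) - ip T.lo T.hi U (fun t => u t - U t) := by
    simp only [ip]
    rw [← intervalIntegral.integral_sub (hu.1.intervalIntegrable_mul h.le hg)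
      (hUL.intervalIntegrable_mul h.le hg)]
    simp only [← sub_mul]
  have h0 : ip T.lo T.hi (fun t => u t - U t) (fun t => u t - U t) = 0 := by
    rw [e₃]
    rw [e₁, hbd, ← hweak, e₂] at hibp
    field_simp at hibp
    linarith
  refine ⟨U, hUp, fun ho => ?_, fun ho => ?_, ?_⟩
  · rcases hyz with ⟨rfl, -, -⟩ | ⟨-, -, h'⟩
    · exact hUy
    · exact absurd (h'.symm.trans ho) hn
  · rcases hyz with ⟨-, -, h'⟩ | ⟨rfl, -, -⟩
    · exact absurd (ho.symm.trans h') hn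
    · exact hUy
  · filter_upwards [ae_eq_zero_of_ip_self h.le hg h0] with t ht
    exact sub_eq_zero.1 ht

/-! ### The patch estimate -/

/-- A function that vanishes at the end points of the patch, except possibly at the outflow
vertex, has a primitive that is bounded by the Poincaré-Friedrichs constant and that vanishes at
the outflow vertex. -/
theorem exists_dual (β : ℝ) (a : Fin (T.n + 1)) {z : ℝ → ℝ}
    (hz : ContinuousOn z (Icc (T.pl a) (T.pr a)))
    (hl : z (T.pl a) = 0 ∨ a = T.outflow β ∧ T.pl a = T.x a)
    (hr : z (T.pr a) = 0 ∨ a = T.outflow β ∧ T.pr a = T.x a) :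
    ∃ v : ℝ → ℝ, IsPrimitive (T.pl a) (T.pr a) v z ∧
      v (T.pr a) * z (T.pr a) - v (T.pl a) * z (T.pl a) = 0 ∧
      l2norm (T.pl a) (T.pr a) v ≤
        T.cPF β a * T.patchDiam a * l2norm (T.pl a) (T.pr a) z := by
  have h := T.pl_lt_pr a
  have hx : T.x a ∈ Icc (T.pl a) (T.pr a) := ⟨T.pl_le a, T.le_pr a⟩
  have hV := (hz.isL2.intervalIntegrable h.le).isPrimitive h.le hx 0
  have hH := hV.isH1 h.le hz.isL2
  unfold patchDiam
  -- The primitive based at `x a` serves the Friedrichs case as it stands; in the Poincaré case its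
  -- mean is subtracted, and `z` vanishes at both ends.
  by_cases ha : a = T.outflow β
  · refine ⟨_, hV, ?_, ?_⟩
    · have e₁ : (fun t => 0 + ∫ s in T.x a..t, z s) (T.pl a) * z (T.pl a) = 0 := by
        rcases hl with h' | ⟨-, h'⟩ <;> simp [h']
      have e₂ : (fun t => 0 + ∫ s in T.x a..t, z s) (T.pr a) * z (T.pr a) = 0 := by
        rcases hr with h' | ⟨-, h'⟩ <;> simp [h']
      rw [e₁, e₂, sub_zero]
    · rw [cPF, if_pos ha, mul_assoc]
      exact hH.le_friedrichsConst h hx (by simp)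
  · refine ⟨_, hV.sub_const ((∫ r in T.pl a..T.pr a, (0 + ∫ s in T.x a..r, z s)) /
      (T.pr a - T.pl a)), ?_, ?_⟩
    · rw [hl.resolve_right fun h' => ha h'.1, hr.resolve_right fun h' => ha h'.1]
      simp
    · rw [cPF, if_neg ha, mul_assoc]
      exact hH.le_poincareConst h

/-- The weighted patch solution has the expected derivative. -/
theorem IsPatchSolution.ae_deriv_eq {T : Mesh} {β : ℝ} {f uh s q : ℝ → ℝ} {m : ℕ}
    {a : Fin (T.n + 1)} (hf : IsL2 (T.pl a) (T.pr a) fun t => f t * T.hat a t)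
    (huh : T.IsPatchPoly m a uh) (hs : T.IsPatchSolution β f uh m a s)
    (hq : T.IsPatchProj m a (fun t => f t * T.hat a t) q) :
    ∀ᵐ t ∂volume.restrict (Ioo (T.pl a) (T.pr a)),
      β * deriv (fun r => T.hat a r * s r) t = q t + β * deriv (T.hat a) t * uh t := by
  have h := (T.pl_lt_pr a).le
  set P : ℝ → ℝ := fun t => β * deriv (fun r => T.hat a r * s r) t with hP
  set S : ℝ → ℝ := fun t => β * deriv (T.hat a) t * uh t with hS
  have hPp : T.IsPatchPoly m a P := by
    have := T.isPatchPoly_deriv_hat_mul hs.1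
    rw [isPatchPoly_iff] at this ⊢
    exact ⟨this.1.const_mul β, this.2.const_mul β⟩
  have hSp : T.IsPatchPoly m a S := by
    have := T.isPatchPoly_deriv_hat a
    rw [isPatchPoly_iff] at this huh ⊢
    exact ⟨((this.1.const_mul β).mul huh.1).mono (zero_add m).le,
      ((this.2.const_mul β).mul huh.2).mono (zero_add m).le⟩
  -- The defect lies in `P_m(𝒯_a)`, so it can be tested with itself: both the patch problem and the
  -- projection are orthogonality relations against this space.
  have hWp : T.IsPatchPoly m a (fun t => P t - q t - S t) := by
    have hq' := hq.1
    rw [isPatchPoly_iff] at hPp hSp hq' ⊢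
    exact ⟨(hPp.1.sub hq'.1).sub hSp.1, (hPp.2.sub hq'.2).sub hSp.2⟩
  have hW := hWp.isL2
  have e₁ := hs.2.2 _ hWp
  have e₂ := hq.2 _ hWp
  have h0 : ip (T.pl a) (T.pr a) (fun t => P t - q t - S t) (fun t => P t - q t - S t) = 0 := by
    have : ip (T.pl a) (T.pr a) (fun t => P t - q t - S t) (fun t => P t - q t - S t) =
        ip (T.pl a) (T.pr a) P (fun t => P t - q t - S t) -
        ip (T.pl a) (T.pr a) (fun t => f t * T.hat a t + S t) (fun t => P t - q t - S t) +
        ip (T.pl a) (T.pr a) (fun t => f t * T.hat a t - q t) (fun t => P t - q t - S t) := by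
      unfold ip
      rw [← intervalIntegral.integral_sub (hPp.isL2.intervalIntegrable_mul h hW)
        ((hf.add hSp.isL2).intervalIntegrable_mul h hW), ← intervalIntegral.integral_add
        ((hPp.isL2.intervalIntegrable_mul h hW).sub
          ((hf.add hSp.isL2).intervalIntegrable_mul h hW))
        ((hf.sub hq.1.isL2).intervalIntegrable_mul h hW)]
      congr 1; ext t; ring
    rw [this, e₁, e₂]
    simp [hS]
  filter_upwards [ae_eq_zero_of_ip_self h hW h0] with t ht
  linarith

/-- By Galerkin orthogonality, the weighted patch solution vanishes at the end points of the patch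
unless the vertex is the outflow vertex. -/
theorem IsPatchSolution.hat_mul_eq_zero {T : Mesh} {β : ℝ} {f uh s : ℝ → ℝ} {m : ℕ}
    {a : Fin (T.n + 1)} (hβ : β ≠ 0) (hf : IsL2 (T.pl a) (T.pr a) f)
    (huh : T.IsPatchPoly m a uh) (hs : T.IsPatchSolution β f uh m a s)
    (ho : ip (T.pl a) (T.pr a) f (T.hat a) +
      ip (T.pl a) (T.pr a) uh (fun t => β * deriv (T.hat a) t) = 0) :
    T.hat a (T.pl a) * s (T.pl a) = 0 ∧ T.hat a (T.pr a) * s (T.pr a) = 0 := by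
  have h := (T.pl_lt_pr a).le
  obtain ⟨g, hg⟩ := hs.2.1
  have hp := T.isPrimitive_hat_mul hs.1 hg.continuousOn
  have hD : IsL2 (T.pl a) (T.pr a) fun t => β * deriv (T.hat a) t :=
    (T.isPatchPoly_deriv_hat a).isL2.const_mul β
  have hH : IsL2 (T.pl a) (T.pr a) (T.hat a) := (T.isPatchPoly_hat a).isL2
  -- Testing with `1` turns the hypothesis `ho` into `∫ (ψ_a s)' = 0`, so `ψ_a s` takes equal values
  -- at the two ends of the patch; at least one of them is zero, because a vertex cannot be both
  -- first and last.
  have e := hs.2.2 (fun _ => 1) (T.isPatchPoly_iff.2 ⟨.const 1, .const 1⟩)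
  have e₂ : ip (T.pl a) (T.pr a) (fun t => f t * T.hat a t + β * deriv (T.hat a) t * uh t)
      (fun _ => 1) = 0 := by
    rw [← ho]
    unfold ip
    rw [← intervalIntegral.integral_add (hf.intervalIntegrable_mul h hH)
      (huh.isL2.intervalIntegrable_mul h hD)]
    congr 1; ext t; ring
  rw [e₂] at e
  simp only [ip, mul_one, intervalIntegral.integral_const_mul] at e
  have e₃ := (mul_eq_zero.1 e).resolve_left hβ
  rw [← hp.sub_eq h] at e₃
  have e₄ : T.hat a (T.pr a) * s (T.pr a) = T.hat a (T.pl a) * s (T.pl a) := sub_eq_zero.1 e₃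
  rcases T.hat_pl a with h' | h'
  · rw [e₄, h', zero_mul]; simp
  · rcases T.hat_pr a with h'' | h''
    · rw [← e₄, h'', zero_mul]; simp
    · have := T.n_pos
      rw [h', Fin.ext_iff, Fin.val_zero, Fin.val_last] at h''
      omega

/-- The local form of the theorem: the duality argument is applied to `z = ψ_a U - ψ_a s`, and the
contribution `1` in `contPF` comes from replacing `u` by `u_h`. -/
theorem l2norm_hat_mul_le {β : ℝ} {f u uh s : ℝ → ℝ} {m : ℕ} (hβ : β ≠ 0)
    (hf : IsL2 T.lo T.hi f) (hu : T.IsUltraWeakSolution β f u) (a : Fin (T.n + 1))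
    (huh : T.IsPatchPoly m a uh)
    (ho : a ≠ T.outflow β → ip (T.pl a) (T.pr a) f (T.hat a) +
      ip (T.pl a) (T.pr a) uh (fun t => β * deriv (T.hat a) t) = 0)
    (hs : T.IsPatchSolution β f uh m a s) :
    l2norm (T.pl a) (T.pr a) (fun t => T.hat a t * (uh t - s t)) ≤
      T.contPF β * l2norm (T.pl a) (T.pr a) (fun t => u t - uh t) +
        T.patchDiam a / (Real.pi * |β|) * l2norm (T.pl a) (T.pr a)
          (fun t => f t * T.hat a t - T.patchProj m a (fun r => f r * T.hat a r) t) := by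
  have h := T.pl_lt_pr a
  have hl := T.lo_le_pl a
  have hr := T.pr_le_hi a
  obtain ⟨U, hU, hUlo, hUhi, huU⟩ := hu.exists_primitive hβ hf
  obtain ⟨g, hg⟩ := hs.2.1
  have hfp : IsL2 (T.pl a) (T.pr a) f := hf.mono hl hr
  have hhat := T.isPrimitive_hat a
  have hhatc := hhat.continuousOn h.le
  have hff : IsL2 (T.pl a) (T.pr a) fun t => f t * T.hat a t := by
    simpa only [mul_comm] using hfp.continuousOn_mul hhatc
  have hq := T.isPatchProj_patchProj m a _ hff
  set q := T.patchProj m a (fun r => f r * T.hat a r) with hqdef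
  have hUp : IsPrimitive (T.pl a) (T.pr a) U (fun t => β⁻¹ * f t) := hU.mono hl h.le hr
  have hUe : ∀ᵐ t ∂volume.restrict (Ioo (T.pl a) (T.pr a)), u t = U t :=
    ae_mono (Measure.restrict_mono (Ioo_subset_Ioo hl hr) le_rfl) huU
  have hE : IsL2 (T.pl a) (T.pr a) fun t => u t - uh t := (hu.1.mono hl hr).sub huh.isL2
  have hz := (hhat.mul hUp h.le).sub (T.isPrimitive_hat_mul hs.1 hg.continuousOn)
  have hzc := hz.continuousOn h.le
  have hR := hff.sub hq.1.isL2
  have hR0 : ∫ t in T.pl a..T.pr a, (f t * T.hat a t - q t) = 0 := by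
    simpa [ip] using hq.2 (fun _ => 1) (T.isPatchPoly_iff.2 ⟨.const 1, .const 1⟩)
  have hbl : T.hat a (T.pl a) * U (T.pl a) - T.hat a (T.pl a) * s (T.pl a) = 0 ∨
      a = T.outflow β ∧ T.pl a = T.x a := by
    by_cases ha : a = T.outflow β
    · rcases T.hat_pl a with h' | h'
      · simp [h']
      · exact Or.inr ⟨ha, (T.pl_eq_iff a).2 h'⟩
    · left
      rw [(hs.hat_mul_eq_zero hβ hfp huh (ho ha)).1, sub_zero, mul_eq_zero]
      -- What remains is a boundary vertex other than the outflow one, that is, the inflow vertex;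
      -- there `U` vanishes although the hat function does not.
      refine (T.hat_pl a).imp_right fun h' => ?_
      have : T.outflow β = Fin.last T.n := by
        unfold outflow at ha ⊢
        split_ifs at ha ⊢ with hb
        · rfl
        · exact absurd h' ha
      rw [(T.pl_eq_iff a).2 h', h']
      exact hUlo this
  have hbr : T.hat a (T.pr a) * U (T.pr a) - T.hat a (T.pr a) * s (T.pr a) = 0 ∨
      a = T.outflow β ∧ T.pr a = T.x a := by
    by_cases ha : a = T.outflow β
    · rcases T.hat_pr a with h' | h'
      · simp [h']
      · exact Or.inr ⟨ha, (T.pr_eq_iff a).2 h'⟩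
    · left
      rw [(hs.hat_mul_eq_zero hβ hfp huh (ho ha)).2, sub_zero, mul_eq_zero]
      refine (T.hat_pr a).imp_right fun h' => ?_
      have : T.outflow β = 0 := by
        unfold outflow at ha ⊢
        split_ifs at ha ⊢ with hb
        · exact absurd h' ha
        · rfl
      rw [(T.pr_eq_iff a).2 h', h']
      exact hUhi this
  obtain ⟨v, hv, hbd, hvz⟩ := T.exists_dual β a hzc hbl hbr
  have hmain := l2norm_le_of_dual (R := fun t => f t * T.hat a t - q t)
    (D := deriv (T.hat a)) (E := fun t => u t - uh t) h hβ hz hv hbd (by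
      filter_upwards [hUe, hs.ae_deriv_eq hff huh hq] with t h₁ h₂
      rw [h₁]
      have : β * (β⁻¹ * f t) = f t := mul_inv_cancel_left₀ hβ _
      linear_combination T.hat a t * this - h₂) hR hR0 hE
    (measurable_deriv _).aestronglyMeasurable (T.ae_abs_deriv_hat_le a) (T.hatGradSup_nonneg a)
    (mul_nonneg (T.cPF_nonneg β a) (T.patchDiam_pos a).le) hvz
  have hEle : l2norm (T.pl a) (T.pr a) (fun t => -T.hat a t * (u t - uh t)) ≤
      l2norm (T.pl a) (T.pr a) (fun t => u t - uh t) := by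
    refine l2norm_le_of_abs_le h.le hE (Filter.Eventually.of_forall fun t => ?_)
    rw [abs_mul, abs_neg]
    exact mul_le_of_le_one_left (abs_nonneg _) (T.abs_hat_le_one a t)
  -- Insert `ψ_a U`, which equals `ψ_a u` almost everywhere.
  have hsplit : l2norm (T.pl a) (T.pr a) (fun t => T.hat a t * (uh t - s t)) =
      l2norm (T.pl a) (T.pr a) (fun t => -T.hat a t * (u t - uh t) +
        (T.hat a t * U t - T.hat a t * s t)) := by
    refine l2norm_congr h.le ?_
    filter_upwards [hUe] with t ht
    rw [ht]; ring
  rw [hsplit]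
  have htri := l2norm_add_le h.le (hE.continuousOn_mul hhatc.neg) hzc.isL2
  have hc := mul_le_mul_of_nonneg_right (T.le_contPF β a)
    (l2norm_nonneg (T.pl a) (T.pr a) (fun t => u t - uh t))
  refine htri.trans ?_
  simp only [Pi.neg_apply]
  unfold patchDiam at *
  linarith

end Mesh
end Advection

theorem theorem7p1 :
    ∃ C : ℝ → ℝ, ∀ (T : Advection.Mesh) (β : ℝ), β ≠ 0 →
      -- the constant is bounded by a quantity that depends only on the shape regularity
      (∀ κ : ℝ, T.ShapeRegular κ → T.contPF β ≤ C κ) ∧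
      -- local efficiency
      ∀ (f u uh : ℝ → ℝ) (k m : ℕ) (s : Fin (T.n + 1) → ℝ → ℝ),
        Advection.IsL2 T.lo T.hi f →
        T.IsUltraWeakSolution β f u →
        T.IsPiecewisePoly k uh →
        T.HatOrthogonal β f uh →
        k ≤ m →
        (∀ a : Fin (T.n + 1), T.IsPatchSolution β f uh m a (s a)) →
        ∀ i : Fin T.n,
          Advection.l2norm (T.x i.castSucc) (T.x i.succ)
              (fun t => uh t - T.reconstruction s t) ≤
            T.contPF β * ∑ a ∈ T.elemVertices i,
              Advection.l2norm (T.pl a) (T.pr a) (fun t => u t - uh t) +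
            ∑ a ∈ T.elemVertices i, T.patchDiam a / (Real.pi * |β|) *
              Advection.l2norm (T.pl a) (T.pr a)
                (fun t => f t * T.hat a t -
                  T.patchProj m a (fun r => f r * T.hat a r) t) := by
  refine ⟨fun κ => 2 + |κ|, fun T β hβ => ⟨fun κ hκ => T.contPF_le hκ β, ?_⟩⟩
  intro f u uh k m s hf hu huh ho hkm hs i
  have hpoly : ∀ a, T.IsPatchPoly m a uh := fun a j _ => by
    obtain ⟨p, hp, hpe⟩ := huh j
    exact ⟨p, hp.trans hkm, hpe⟩
  have hmain := fun a => T.l2norm_hat_mul_le hβ hf hu a (hpoly a) (ho a) (hs a)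
  have hlt := T.strictMono i.castSucc_lt_succ
  have hL2 : ∀ a, Advection.IsL2 (T.pl a) (T.pr a) (fun t => T.hat a t * (uh t - s a t)) := by
    intro a
    obtain ⟨g, hg⟩ := (hs a).2.1
    exact ((hpoly a).isL2.sub hg.continuousOn.isL2).continuousOn_mul
      ((T.isPrimitive_hat a).continuousOn (T.pl_lt_pr a).le)
  have b₁ : T.pl i.castSucc ≤ T.x i.castSucc := T.pl_le _
  have b₂ : T.x i.succ ≤ T.pr i.castSucc := (T.pr_castSucc i).ge
  have b₃ : T.pl i.succ ≤ T.x i.castSucc := (T.pl_succ i).le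
  have b₄ : T.x i.succ ≤ T.pr i.succ := T.le_pr _
  -- Partition of unity on the element: `u_h` is distributed over the two hat functions, so each
  -- summand is controlled on its own patch.
  have hsplit : Advection.l2norm (T.x i.castSucc) (T.x i.succ)
      (fun t => uh t - T.reconstruction s t) =
      Advection.l2norm (T.x i.castSucc) (T.x i.succ)
        (fun t => T.hat i.castSucc t * (uh t - s i.castSucc t) +
          T.hat i.succ t * (uh t - s i.succ t)) := by
    refine Advection.l2norm_congr hlt.le ?_
    filter_upwards [ae_restrict_mem measurableSet_Ioo] with t ht
    rw [Advection.Mesh.reconstruction, T.sum_hat_mul ht fun a => s a t]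
    linear_combination (-uh t) * T.hat_add_hat ht
  have hne : i.castSucc ≠ i.succ := i.castSucc_lt_succ.ne
  unfold Advection.Mesh.elemVertices
  rw [Finset.sum_pair hne, Finset.sum_pair hne, hsplit]
  have htri := Advection.l2norm_add_le hlt.le ((hL2 i.castSucc).mono b₁ b₂)
    ((hL2 i.succ).mono b₃ b₄)
  have m₁ := Advection.l2norm_mono (hL2 i.castSucc) b₁ hlt.le b₂
  have m₂ := Advection.l2norm_mono (hL2 i.succ) b₃ hlt.le b₄
  have h₁ := hmain i.castSucc
  have h₂ := hmain i.succ
  linarith
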